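/- Let $A$ be a C*-algebra. Write $\mathcal U(A)$ for its unitary group (the unitaries of $A$ if $A$ is unital, of $A+\mathbb C1$ otherwise), with the norm topology, and put $\operatorname{Ad}u(x)=uxu^*$ for $u\in\mathcal U(A)$, $x\in A$. For a state $\omega$ of $A$ let $\pi_\omega$ be its GNS representation on the Hilbert space $\mathcal H_\omega$, and let $\mathcal K(\mathcal H_\omega)$ be the algebra of compact operators on $\mathcal H_\omega$. Let $\mathrm{AI}_0(A)$ be the set of automorphisms $\alpha$ of $A$ for which there is a continuous family $(u_t)_{t\in[0,\infty)}$ in $\mathcal U(A)$ with $u_0=1$ and $\alpha(x)=\lim_{t\to\infty}\operatorname{Ad}u_t(x)$ in norm for every $x\in A$. The algebra $A$ is said to have Property A if for any finite subset $\mathcal F$ of $A$, any pure state $\omega$ of $A$ with $\pi_\omega(A)\cap\mathcal K(\mathcal H_\omega)=(0)$, and any $\varepsilon>0$, there exist a finite subset $\mathcal G$ of $A$ and $\delta>0$ such that: if $\varphi$ is a pure state of $A$ such that $\pi_\varphi$ is quasi-equivalent to $\pi_\omega$ and $|\varphi(x)-\omega(x)|<\delta$ for all $x\in\mathcal G$,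 then there is a continuous path $(u_t)_{t\in[0,1]}$ in $\mathcal U(A)$ such that $u_0=1$, $\varphi=\omega\circ\operatorname{Ad}u_1$, and $\|\operatorname{Ad}u_t(x)-x\|<\varepsilon$ for all $x\in\mathcal F$ and $t\in[0,1]$. **Theorem 2.1.** Let $A$ be a separable C*-algebra with Property A. If $\omega_1$ and $\omega_2$ are pure states of $A$ such that $\ker\pi_{\omega_1}=\ker\pi_{\omega_2}$, then there is an $\alpha\in\mathrm{AI}_0(A)$ such that $\omega_1=\omega_2\circ\alpha$. -/

import Mathlib

open scoped ComplexOrder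
open Filter Topology TopologicalSpace

namespace CStarPure

section Unitaries

variable (A : Type*) [NonUnitalCStarAlgebra A]

/-- The unitary group `U(A)` of a C⋆-algebra `A`: the unitaries of `A` if `A` has an identity, the
unitaries of `A + ℂ1` otherwise.

Everything is placed in the C⋆-unitization `A + ℂ1`. If `A` has an identity `e`, a unitary `v` of
`A` corresponds to the unitary `v + (1 - e)` of the unitization, and these are exactly the unitaries
with scalar part `1` (see `mem_unitaryGroup_iff_of_unital`); the identification `v ↦ v + (1 - e)` is
an isomorphism of topological groups onto its image. If `A` has no identity, there is no
restriction. -/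
noncomputable def unitaryGroup : Subgroup (unitary (Unitization ℂ A)) where
  carrier := {u | (∃ e : A, ∀ a : A, e * a = a ∧ a * e = a) → (u : Unitization ℂ A).fst = 1}
  mul_mem' := by
    intro u v hu hv he
    simp [hu he, hv he]
  one_mem' := by
    intro _
    simp
  inv_mem' := by
    intro u hu he
    have h : ((u⁻¹ : unitary (Unitization ℂ A)) : Unitization ℂ A) = star (u : Unitization ℂ A) :=
      rfl
    rw [h, Unitization.fst_star, hu he, star_one]

variable {A}

/-- `Ad u (a) = u a u*` for `u` in the unitary group of `A` and `a` in `A`. The product, formed in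
the unitization, lies in the ideal `A` (see `inr_Ad`), and `snd` reads it off as an element of
`A`. -/
noncomputable def Ad (u : unitaryGroup A) (a : A) : A :=
  ((u : Unitization ℂ A) * (a : Unitization ℂ A) * star (u : Unitization ℂ A)).snd

theorem inr_Ad (u : unitaryGroup A) (a : A) :
    Unitization.inr (Ad u a) =
      (u : Unitization ℂ A) * (a : Unitization ℂ A) * star (u : Unitization ℂ A) := by
  apply Unitization.ext
  · simp
  · rfl

variable (A) in
/-- The set `AI₀(A)` of the automorphisms `α` of `A` for which there is a norm continuous family
`(u_t)`, `t ∈ [0, ∞)`, in `U(A)` with `u_0 = 1` and `α = lim Ad u_t` pointwise in norm. -/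
def AI₀ : Set (A ≃⋆ₐ[ℂ] A) :=
  {α | ∃ u : NNReal → unitaryGroup A, Continuous u ∧ u 0 = 1 ∧
    ∀ a : A, Tendsto (fun t => Ad (u t) a) atTop (𝓝 (α a))}

end Unitaries

section Unital

variable {B : Type*} [CStarAlgebra B]

/-- For an algebra with identity, `unitaryGroup` is the usual unitary group. -/
theorem mem_unitaryGroup_iff_of_unital (u : unitary (Unitization ℂ B)) :
    u ∈ unitaryGroup B ↔
      ∃ v ∈ unitary B, (u : Unitization ℂ B) = ((v - 1 : B) : Unitization ℂ B) + 1 := by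
  constructor
  · intro hu
    have hs : (u : Unitization ℂ B).fst = 1 := hu ⟨1, fun a => by simp⟩
    have h1 := congrArg (fun z : Unitization ℂ B => z.snd) (Unitary.mem_iff.mp u.2).1
    have h2 := congrArg (fun z : Unitization ℂ B => z.snd) (Unitary.mem_iff.mp u.2).2
    simp only [Unitization.snd_mul, Unitization.fst_star, Unitization.snd_star, hs,
      Unitization.snd_one, star_one, one_smul] at h1 h2
    refine ⟨(u : Unitization ℂ B).snd + 1, ?_, ?_⟩
    · rw [Unitary.mem_iff, star_add, star_one]
      constructor
      · rw [add_mul, mul_add, one_mul, mul_one, ← add_assoc]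
        rw [← sub_eq_zero, ← h1]
        noncomm_ring
      · rw [add_mul, mul_add, one_mul, mul_one, ← add_assoc]
        rw [← sub_eq_zero, ← h2]
        noncomm_ring
    · apply Unitization.ext
      · rw [Unitization.fst_add, Unitization.fst_inr, Unitization.fst_one, hs, zero_add]
      · rw [Unitization.snd_add, Unitization.snd_inr, Unitization.snd_one, add_zero,
          add_sub_cancel_right]
  · rintro ⟨v, -, hv⟩ -
    rw [hv, Unitization.fst_add, Unitization.fst_inr, Unitization.fst_one, zero_add]

/-- For an algebra with identity, `Ad` is the usual conjugation. -/
theorem Ad_eq_of_unital (u : unitaryGroup B) (v : B)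
    (h : (u : Unitization ℂ B) = ((v - 1 : B) : Unitization ℂ B) + 1) (a : B) :
    Ad u a = v * a * star v := by
  rw [Ad, h]
  simp only [Unitization.snd_mul, Unitization.fst_mul, Unitization.fst_star, Unitization.snd_star,
    Unitization.fst_add, Unitization.snd_add, Unitization.fst_inr, Unitization.snd_inr,
    Unitization.fst_one, Unitization.snd_one, zero_add, add_zero, star_one, one_smul, zero_smul,
    mul_zero, star_sub]
  noncomm_ring

end Unital

section Representations

variable {A : Type*} [NonUnitalCStarAlgebra A]
  {H : Type*} [NormedAddCommGroup H] [InnerProductSpace ℂ H] [CompleteSpace H]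
  {K : Type*} [NormedAddCommGroup K] [InnerProductSpace ℂ K] [CompleteSpace K]

/-- The bicommutant `π(A)''` of a representation `π` of `A` on a Hilbert space `H`. -/
noncomputable def bicommutant (π : A →⋆ₙₐ[ℂ] (H →L[ℂ] H)) : StarSubalgebra ℂ (H →L[ℂ] H) :=
  StarSubalgebra.centralizer ℂ
    (StarSubalgebra.centralizer ℂ (Set.range π) : Set (H →L[ℂ] H))

theorem mem_bicommutant (π : A →⋆ₙₐ[ℂ] (H →L[ℂ] H)) (a : A) : π a ∈ bicommutant π := by
  rw [bicommutant, StarSubalgebra.mem_centralizer_iff]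
  intro g hg
  have h := (StarSubalgebra.mem_centralizer_iff ℂ).mp hg (π a) ⟨a, rfl⟩
  have h' := (StarSubalgebra.mem_centralizer_iff ℂ).mp (star_mem hg) (π a) ⟨a, rfl⟩
  exact ⟨h.1.symm, h'.1.symm⟩

/-- Two (nondegenerate) representations `π` and `ρ` of `A` are quasi-equivalent if there is an
isomorphism of `π(A)''` onto `ρ(A)''` that carries `π a` to `ρ a` for all `a` in `A`. -/
def QuasiEquivalent (π : A →⋆ₙₐ[ℂ] (H →L[ℂ] H)) (ρ : A →⋆ₙₐ[ℂ] (K →L[ℂ] K)) : Prop :=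
  ∃ Φ : bicommutant π ≃⋆ₐ[ℂ] bicommutant ρ,
    ∀ a : A, Φ ⟨π a, mem_bicommutant π a⟩ = ⟨ρ a, mem_bicommutant ρ a⟩

/-- `π(A) ∩ K(H) = (0)`, where `K(H)` is the algebra of compact operators on `H`. -/
def MeetsCompactsTrivially (π : A →⋆ₙₐ[ℂ] (H →L[ℂ] H)) : Prop :=
  ∀ a : A, IsCompactOperator (π a) → π a = 0

end Representations

section PureStates

variable {A : Type*} [NonUnitalCStarAlgebra A] [PartialOrder A] [StarOrderedRing A]

/-- A state: a positive linear functional of norm one. -/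
def IsState (φ : A →ₚ[ℂ] ℂ) : Prop :=
  ‖(⟨φ.toLinearMap, map_continuous φ⟩ : A →L[ℂ] ℂ)‖ = 1

/-- A pure state: a state `φ` such that the only positive linear functionals majorized by `φ` are
the multiples `t φ` with `0 ≤ t ≤ 1`. -/
def IsPureState (φ : A →ₚ[ℂ] ℂ) : Prop :=
  IsState φ ∧ ∀ ψ : A →ₚ[ℂ] ℂ, (∀ a : A, 0 ≤ a → ψ a ≤ φ a) →
    ∃ t : ℝ, 0 ≤ t ∧ t ≤ 1 ∧ ∀ a : A, ψ a = (t : ℂ) * φ a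

variable (A) in
/-- Given a finite set `F ⊆ A`, a pure state `ω` with `π_ω(A) ∩ K(H_ω) = (0)` and `ε > 0`, there are
a finite set `G ⊆ A` and `δ > 0` such that every pure state `φ` which has `π_φ` quasi-equivalent to
`π_ω` and is `δ`-close to `ω` on `G` is of the form `ω ∘ Ad u_1` for a continuous path of unitaries
`(u_t)`, `t ∈ [0, 1]`, with `u_0 = 1` and `‖Ad u_t (x) - x‖ < ε` for all `x ∈ F` and all `t`. -/
def PropertyA : Prop :=
  ∀ (F : Finset A) (ω : A →ₚ[ℂ] ℂ), IsPureState ω →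
    MeetsCompactsTrivially ω.gnsNonUnitalStarAlgHom → ∀ ε : ℝ, 0 < ε →
    ∃ (G : Finset A) (δ : ℝ), 0 < δ ∧
      ∀ φ : A →ₚ[ℂ] ℂ, IsPureState φ →
        QuasiEquivalent φ.gnsNonUnitalStarAlgHom ω.gnsNonUnitalStarAlgHom →
        (∀ x ∈ G, ‖φ x - ω x‖ < δ) →
        ∃ u : unitInterval → unitaryGroup A, Continuous u ∧ u 0 = 1 ∧
          (∀ a : A, φ a = ω (Ad (u 1) a)) ∧
          ∀ x ∈ F, ∀ t : unitInterval, ‖Ad (u t) x - x‖ < ε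

end PureStates

end CStarPure

/-! If one of the two GNS representations contains a nonzero compact operator, the other state is
already a vector state of it (`IsPureState.exists_vector_of_compact`). Kadison transitivity then
carries one state exactly onto the other by a unitary `exp (i h)`, which is joined to `1` by a path.

Otherwise conjugacy is reached only in the limit. Equality of the kernels makes each state a weak*
limit of vector states of the other representation (`IsPureState.exists_vector_approx`), hence, by
transitivity, of unitary conjugates of the other state (`IsPureState.exists_path_conj_approx`). The
conjugating unitary may act on `A` far from trivially. Property A repairs this once the states are
close enough: the same conjugate state is reached along a path that almost commutes with a
prescribed finite set.

The two states are moved alternately towards each other (`Stage.exists_succ`). Before one of them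
moves, the tolerance that Property A demands for the next move of the other is fixed, and the move
is made that precise. The paths concatenate to `V` and `W` with `Ad V_t → α`, `Ad W_t → β` and `ω₁ ∘
α = ω₂ ∘ β`, so `ω₁ = ω₂ ∘ β ∘ α⁻¹`. Controlling both `x i` and `Ad v⁻¹ (x i)` on a dense sequence
makes the inverses converge too, so the limits are automorphisms.

Transitivity rests on the irreducibility of GNS representations of pure states
(`IsPureState.isIrreducible`), a commutant argument on finite amplifications, and Kaplansky's
bounded approximation. -/

namespace CStarPure

/-! ### Strong density of irreducible representations. -/

section Density

variable {A : Type*} [NonUnitalCStarAlgebra A]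
  {H : Type*} [NormedAddCommGroup H] [InnerProductSpace ℂ H]

/-- The Hilbert space direct sum of copies of `H` indexed by a finite type. -/
abbrev Copies (ι H : Type*) := PiLp 2 (fun _ : ι => H)

/-- The diagonal operator `T ⊕ ⋯ ⊕ T` on a finite direct sum of copies of `H`. -/
noncomputable def amplify (ι : Type*) [Fintype ι] (T : H →L[ℂ] H) :
    Copies ι H →L[ℂ] Copies ι H :=
  (PiLp.continuousLinearEquiv 2 ℂ (fun _ : ι => H)).symm.toContinuousLinearMap ∘L
    ContinuousLinearMap.pi (fun i => T ∘L ContinuousLinearMap.proj i) ∘L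
    (PiLp.continuousLinearEquiv 2 ℂ (fun _ : ι => H)).toContinuousLinearMap

@[simp]
theorem amplify_apply {ι : Type*} [Fintype ι] (T : H →L[ℂ] H) (x : Copies ι H)
    (i : ι) : amplify ι T x i = T (x i) := rfl

variable [CompleteSpace H]

/-- A representation is irreducible if it is nondegenerate and has trivial commutant. -/
structure IsIrreducible (π : A →⋆ₙₐ[ℂ] (H →L[ℂ] H)) : Prop where
  eq_zero : ∀ z : H, (∀ a, π a z = 0) → z = 0
  commutant : ∀ T : H →L[ℂ] H, (∀ a, T * π a = π a * T) → ∃ c : ℂ, T = c • 1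

theorem inner_map_star (π : A →⋆ₙₐ[ℂ] (H →L[ℂ] H)) (a : A) (x y : H) :
    inner ℂ (π (star a) x) y = inner ℂ x (π a y) := by
  rw [map_star, ContinuousLinearMap.star_eq_adjoint, ContinuousLinearMap.adjoint_inner_left]

/-- A finite sum of vector functionals that vanishes on an irreducible `π(A)` vanishes on all
operators. -/
theorem IsIrreducible.sum_inner_eq_zero {π : A →⋆ₙₐ[ℂ] (H →L[ℂ] H)} (hπ : IsIrreducible π)
    {ι : Type*} [Fintype ι] (v w : ι → H) (h : ∀ a, ∑ i, inner ℂ (w i) (π a (v i)) = 0)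
    (T : H →L[ℂ] H) : ∑ i, inner ℂ (w i) (T (v i)) = 0 := by
  classical
  let V : Copies ι H := WithLp.toLp 2 v
  let W : Copies ι H := WithLp.toLp 2 w
  let f : A →ₗ[ℂ] Copies ι H :=
    { toFun := fun a => amplify ι (π a) V
      map_add' := fun a b => by
        ext i; simp
      map_smul' := fun c a => by
        ext i; simp }
  let M : Submodule ℂ (Copies ι H) := (LinearMap.range f).topologicalClosure
  have hMcl : IsClosed (M : Set (Copies ι H)) := Submodule.isClosed_topologicalClosure _
  have : CompleteSpace M := hMcl.completeSpace_coe
  have hinv : ∀ a, ∀ x ∈ M, amplify ι (π a) x ∈ M := by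
    intro a
    have hsub : (LinearMap.range f).topologicalClosure ≤
        M.comap (amplify ι (π a)).toLinearMap := by
      apply Submodule.topologicalClosure_minimal
      · rintro _ ⟨b, rfl⟩
        apply Submodule.le_topologicalClosure
        refine ⟨a * b, ?_⟩
        ext i
        simp [f]
      · exact hMcl.preimage (amplify ι (π a)).continuous
    exact fun x hx => hsub hx
  have hadj : ∀ a (x y : Copies ι H), inner ℂ (amplify ι (π (star a)) x) y
      = inner ℂ x (amplify ι (π a) y) := by
    intro a x y
    simp only [PiLp.inner_apply, amplify_apply, inner_map_star]
  let P : Copies ι H →L[ℂ] Copies ι H := M.starProjection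
  have hPmem : ∀ x, P x ∈ M := fun x => Submodule.starProjection_apply_mem _ _
  have hPorth : ∀ x, ∀ m ∈ M, inner ℂ (x - P x) m = 0 := fun x m hm =>
    Submodule.starProjection_inner_eq_zero _ _ hm
  have hcomm : ∀ a x, P (amplify ι (π a) x) = amplify ι (π a) (P x) := by
    intro a x
    apply Submodule.eq_starProjection_of_mem_of_inner_eq_zero (hinv a _ (hPmem x))
    intro m hm
    rw [← map_sub]
    have := hadj (star a) (x - P x) m
    rw [star_star] at this
    rw [this]
    exact hPorth x _ (hinv _ _ hm)
  let sgl : ι → H →L[ℂ] Copies ι H := fun j =>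
    (PiLp.continuousLinearEquiv 2 ℂ (fun _ : ι => H)).symm.toContinuousLinearMap ∘L
      ContinuousLinearMap.single ℂ (fun _ : ι => H) j
  let prj : ι → Copies ι H →L[ℂ] H := fun i =>
    ContinuousLinearMap.proj i ∘L
      (PiLp.continuousLinearEquiv 2 ℂ (fun _ : ι => H)).toContinuousLinearMap
  have hsgl : ∀ (S : H →L[ℂ] H) j x, sgl j (S x) = amplify ι S (sgl j x) := by
    intro S j x
    ext i
    by_cases hij : i = j
    · subst hij; simp [sgl]
    · simp [sgl, hij]
  have hsum : ∀ x : Copies ι H, x = ∑ j, sgl j (x j) := by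
    intro x
    ext i
    have : (∑ j, sgl j (x j)) i = ∑ j, (sgl j (x j)) i := by
      exact map_sum (prj i) (fun j => sgl j (x j)) Finset.univ
    rw [this, Finset.sum_eq_single i]
    · simp [sgl]
    · intro j _ hj
      simp [sgl, hj.symm]
    · simp
  -- The matrix entries of `P` commute with `π(A)`, so they are scalars; a matrix of scalars
  -- commutes with every diagonal operator `T ⊕ ⋯ ⊕ T`.
  have hent : ∀ i j, ∃ c : ℂ, prj i ∘L P ∘L sgl j = c • 1 := by
    intro i j
    apply hπ.commutant
    intro a
    ext x
    change prj i (P (sgl j (π a x))) = π a (prj i (P (sgl j x)))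
    rw [hsgl, hcomm]
    rfl
  have hPT : ∀ x, P (amplify ι T x) = amplify ι T (P x) := by
    intro x
    rw [hsum x, map_sum, map_sum, map_sum, map_sum]
    refine Finset.sum_congr rfl fun j _ => ?_
    rw [← hsgl]
    ext i
    obtain ⟨c, hc⟩ := hent i j
    have h1 : ∀ y, (P (sgl j y)) i = c • y := fun y => by
      have := DFunLike.congr_fun hc y
      simp only [ContinuousLinearMap.comp_apply, smul_apply,
        one_apply_eq_self] at this
      exact this
    rw [amplify_apply, h1, h1, map_smul]
  -- Without a unit in `A`, `V ∈ M` needs an argument: `V - P V` is killed by every `π a`, so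
  -- nondegeneracy applies.
  have hV : P V = V := by
    have h0 : V - P V = 0 := by
      ext i
      change (V - P V) i = 0
      apply hπ.eq_zero
      intro a
      have h1 : amplify ι (π a) (V - P V) = 0 := by
        rw [map_sub, ← hcomm, sub_eq_zero]
        symm
        apply Submodule.eq_starProjection_of_mem_of_inner_eq_zero
        · exact Submodule.le_topologicalClosure _ ⟨a, rfl⟩
        · simp
      have := congrArg (fun z : Copies ι H => z i) h1
      simpa using this
    exact (sub_eq_zero.mp h0).symm
  have hTV : amplify ι T V ∈ M := by
    have : amplify ι T V = P (amplify ι T V) := by rw [hPT, hV]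
    rw [this]
    exact hPmem _
  have hWM : ∀ m ∈ M, inner ℂ W m = 0 := by
    have hcl : IsClosed {m : Copies ι H | inner ℂ W m = 0} := isClosed_eq (by fun_prop) (by fun_prop)
    have hle : closure (LinearMap.range f : Set (Copies ι H)) ⊆ {m : Copies ι H | inner ℂ W m = 0} := by
      apply closure_minimal _ hcl
      rintro _ ⟨a, rfl⟩
      have := h a
      simpa [f, PiLp.inner_apply, W, V] using this
    intro m hm
    exact hle hm
  have := hWM _ hTV
  simpa [PiLp.inner_apply, W, V] using this

/-- The self-adjoint elements of an irreducible representation are strongly dense in the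
self-adjoint operators. -/
theorem IsIrreducible.exists_selfAdjoint_approx {π : A →⋆ₙₐ[ℂ] (H →L[ℂ] H)} (hπ : IsIrreducible π)
    {ι : Type*} [Fintype ι] (v : ι → H) (y : H →L[ℂ] H) (hy : IsSelfAdjoint y) {ε : ℝ}
    (hε : 0 < ε) : ∃ h : A, IsSelfAdjoint h ∧ ∀ i, ‖π h (v i) - y (v i)‖ < ε := by
  let V : Copies ι H := WithLp.toLp 2 v
  let R : Set (Copies ι H) := (fun a => amplify ι (π a) V) '' {a : A | IsSelfAdjoint a}
  have hR : Convex ℝ R := by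
    rintro _ ⟨a, ha, rfl⟩ _ ⟨b, hb, rfl⟩ s t hs ht hst
    refine ⟨(s : ℂ) • a + (t : ℂ) • b, ?_, ?_⟩
    · have ha' : star a = a := ha
      have hb' : star b = b := hb
      change star _ = _
      simp [ha', hb']
    · have hreal : ∀ (r : ℝ) (x : Copies ι H), r • x = (r : ℂ) • x := fun r x => by simp
      ext i
      rw [hreal, hreal]
      dsimp only
      rw [map_add, map_smul, map_smul]
      simp
  by_cases hmem : amplify ι y V ∈ closure R
  · rw [Metric.mem_closure_iff] at hmem
    obtain ⟨_, ⟨h, hh, rfl⟩, hd⟩ := hmem ε hε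
    refine ⟨h, hh, fun i => ?_⟩
    rw [dist_comm, dist_eq_norm] at hd
    dsimp only at hd
    have h1 := PiLp.norm_apply_le (amplify ι (π h) V - amplify ι y V) i
    have h2 : (amplify ι (π h) V - amplify ι y V) i = π h (v i) - y (v i) := by simp [V]
    rw [h2] at h1
    exact lt_of_le_of_lt h1 hd
  · exfalso
    obtain ⟨f, u, hfu, huf⟩ := RCLike.geometric_hahn_banach_closed_point (𝕜 := ℂ)
      hR.closure isClosed_closure hmem
    obtain ⟨z, rfl⟩ := (InnerProductSpace.toDual ℂ (Copies ι H)).surjective f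
    have hu0 : 0 < u := by
      have := hfu 0 (subset_closure ⟨0, by simp, by ext i; simp⟩)
      simpa using this
    -- Values bounded above on a real subspace must vanish: rescaling `h` by `u / c` would attain
    -- the excluded value `u`.
    have hzero : ∀ h : A, IsSelfAdjoint h → (inner ℂ z (amplify ι (π h) V)).re = 0 := by
      intro h hh
      by_contra hne
      set c := (inner ℂ z (amplify ι (π h) V)).re with hc
      have h1 := hfu (amplify ι (π (((u / c : ℝ) : ℂ) • h)) V)
        (subset_closure ⟨_, by
          have hh' : star h = h := hh
          change star _ = _
          rw [star_smul, hh', Complex.star_def, Complex.conj_ofReal], rfl⟩)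
      have h2 : amplify ι (π (((u / c : ℝ) : ℂ) • h)) V
          = ((u / c : ℝ) : ℂ) • amplify ι (π h) V := by
        ext i; simp
      rw [h2, InnerProductSpace.toDual_apply_apply, inner_smul_right] at h1
      simp only [RCLike.re_to_complex, Complex.re_ofReal_mul] at h1
      rw [← hc, div_mul_cancel₀ _ hne] at h1
      exact lt_irrefl _ h1
    let z' : ι → H := fun i => z i
    have hpair : ∀ T : H →L[ℂ] H, IsSelfAdjoint T →
        ∑ i, inner ℂ (v i) (T (z' i)) = (starRingEnd ℂ) (∑ i, inner ℂ (z' i) (T (v i))) := by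
      intro T hT
      rw [map_sum]
      refine Finset.sum_congr rfl fun i _ => ?_
      rw [inner_conj_symm, ← ContinuousLinearMap.adjoint_inner_left,
        ← ContinuousLinearMap.star_eq_adjoint, hT.star_eq]
    -- A real part is only real-linear in the operator. Twice it, written as a sum over `ι ⊕ ι` with
    -- the vectors swapped in the second half, extends complex-linearly, so that `sum_inner_eq_zero`
    -- applies.
    have hsa : ∀ h : A, IsSelfAdjoint h →
        ∑ i, inner ℂ (z' i) (π h (v i)) + ∑ i, inner ℂ (v i) (π h (z' i)) = 0 := by
      intro h hh
      rw [hpair _ (hh.map π), Complex.add_conj]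
      have := hzero h hh
      rw [PiLp.inner_apply] at this
      simp only [amplify_apply] at this
      change (∑ i, inner ℂ (z' i) (π h (v i))).re = 0 at this
      rw [this]
      simp
    have hall : ∀ a : A, ∑ i : ι ⊕ ι, inner ℂ (Sum.elim z' v i) (π a (Sum.elim v z' i)) = 0 := by
      intro a
      rw [Fintype.sum_sum_type]
      simp only [Sum.elim_inl, Sum.elim_inr]
      have h1 := hsa _ (realPart a).2
      have h2 := hsa _ (imaginaryPart a).2
      rw [← realPart_add_I_smul_imaginaryPart a]
      simp only [map_add, map_smul, add_apply, smul_apply,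
        inner_add_right, inner_smul_right, Finset.sum_add_distrib, ← Finset.mul_sum]
      linear_combination h1 + Complex.I * h2
    have hT := hπ.sum_inner_eq_zero _ _ hall y
    rw [Fintype.sum_sum_type] at hT
    simp only [Sum.elim_inl, Sum.elim_inr] at hT
    rw [hpair y hy, Complex.add_conj] at hT
    have h3 : (∑ i, inner ℂ (z' i) (y (v i))).re = 0 := by
      have := congrArg Complex.re hT
      simpa using this
    rw [InnerProductSpace.toDual_apply_apply, PiLp.inner_apply] at huf
    simp only [amplify_apply] at huf
    have : RCLike.re (∑ i, inner ℂ (z' i) (y (v i))) = 0 := h3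
    change u < RCLike.re (∑ i, inner ℂ (z' i) (y (v i))) at huf
    linarith

end Density

/-! ### Kaplansky density. -/

section Kaplansky

/-- The function `t ↦ 2t / (1 + t²)`, which maps `ℝ` into `[-1, 1]`. -/
noncomputable def kaplanskyFun (t : ℝ) : ℝ := 2 * t * (1 + t ^ 2)⁻¹

theorem continuous_kaplanskyFun : Continuous kaplanskyFun := by
  unfold kaplanskyFun
  exact Continuous.mul (by fun_prop)
    (Continuous.inv₀ (by fun_prop) fun t => by positivity)

theorem abs_kaplanskyFun_le (t : ℝ) : |kaplanskyFun t| ≤ 1 := by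
  unfold kaplanskyFun
  have h : 0 < 1 + t ^ 2 := by positivity
  rw [abs_mul, abs_inv, abs_of_pos h, ← div_eq_mul_inv, div_le_one h, abs_mul, abs_two]
  nlinarith [sq_nonneg (|t| - 1), sq_abs t]

/-- A right inverse of `kaplanskyFun` on `[-1, 1]`. -/
noncomputable def kaplanskyInv (s : ℝ) : ℝ := s * (1 + √(1 - s ^ 2))⁻¹

theorem continuous_kaplanskyInv : Continuous kaplanskyInv := by
  unfold kaplanskyInv
  exact continuous_id.mul (Continuous.inv₀ (by fun_prop) fun t => by positivity)

theorem kaplanskyFun_kaplanskyInv {s : ℝ} (hs : |s| ≤ 1) : kaplanskyFun (kaplanskyInv s) = s := by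
  have h1 : 0 ≤ 1 - s ^ 2 := by nlinarith [sq_abs s, abs_nonneg s]
  unfold kaplanskyFun kaplanskyInv
  have h2 : √(1 - s ^ 2) ^ 2 = 1 - s ^ 2 := Real.sq_sqrt h1
  set r := √(1 - s ^ 2) with hr
  have h3 : 0 < 1 + r := by positivity
  have hs2 : s ^ 2 = 1 - r ^ 2 := by linarith
  rw [mul_pow, hs2]
  have h4 : 1 + (1 - r ^ 2) * (1 + r)⁻¹ ^ 2 = 2 * (1 + r)⁻¹ := by
    field_simp
    ring
  rw [h4]
  field_simp

variable {B : Type*} [CStarAlgebra B]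

/-- A resolvent-type identity. Applied to a vector, the difference `x - y` acts only on vectors
determined by `y`, and the factors to its left have norm at most one; hence strong approximation of
`y` by `x`, even unbounded, passes to `kaplanskyFun`. -/
theorem cfc_kaplanskyFun_sub (x y : B) (hx : IsSelfAdjoint x) (hy : IsSelfAdjoint y) :
    cfc kaplanskyFun x - cfc kaplanskyFun y =
      (2 : ℝ) • (cfc (fun t : ℝ => (1 + t ^ 2)⁻¹) x * ((x - y) * cfc (fun t : ℝ => (1 + t ^ 2)⁻¹) y))
        + (1 / 2 : ℝ) • (cfc kaplanskyFun x * ((y - x) * cfc kaplanskyFun y)) := by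
  have hc : Continuous fun t : ℝ => (1 + t ^ 2)⁻¹ :=
    Continuous.inv₀ (by fun_prop) fun t => by positivity
  have hp : ∀ z : B, IsSelfAdjoint z → cfc (fun t : ℝ => 1 + t ^ 2) z = 1 + z * z := by
    intro z hz
    rw [cfc_const_add (1 : ℝ) (fun t => t ^ 2) z, map_one, cfc_pow_id z 2, sq]
  have h1 : ∀ z : B, IsSelfAdjoint z → cfc (fun t : ℝ => (1 + t ^ 2)⁻¹) z * (1 + z * z) = 1 := by
    intro z hz
    rw [← hp z hz, ← cfc_mul _ _ z hc.continuousOn (by fun_prop), ← cfc_const_one ℝ z]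
    congr 1
    ext t
    have : 1 + t ^ 2 ≠ 0 := by positivity
    simp [this]
  have h2 : ∀ z : B, IsSelfAdjoint z → (1 + z * z) * cfc (fun t : ℝ => (1 + t ^ 2)⁻¹) z = 1 := by
    intro z hz
    rw [← hp z hz, ← cfc_mul _ _ z (by fun_prop) hc.continuousOn, ← cfc_const_one ℝ z]
    congr 1
    ext t
    have : 1 + t ^ 2 ≠ 0 := by positivity
    simp [this]
  have hF : ∀ z : B, IsSelfAdjoint z →
      cfc kaplanskyFun z = (2 : ℝ) • (z * cfc (fun t : ℝ => (1 + t ^ 2)⁻¹) z) := by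
    intro z hz
    have : kaplanskyFun = fun t : ℝ => (2 : ℝ) • (t * (1 + t ^ 2)⁻¹) := by
      ext t; simp [kaplanskyFun, mul_assoc]
    rw [this, cfc_smul (2 : ℝ) (fun t => t * (1 + t ^ 2)⁻¹) z (continuous_id.mul hc).continuousOn,
      cfc_mul (fun t => t) _ z (by fun_prop) hc.continuousOn, cfc_id' ℝ z]
  have hF' : ∀ z : B, IsSelfAdjoint z →
      cfc kaplanskyFun z = (2 : ℝ) • (cfc (fun t : ℝ => (1 + t ^ 2)⁻¹) z * z) := by
    intro z hz
    have : kaplanskyFun = fun t : ℝ => (2 : ℝ) • ((1 + t ^ 2)⁻¹ * t) := by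
      ext t; simp [kaplanskyFun]; ring
    rw [this, cfc_smul (2 : ℝ) (fun t => (1 + t ^ 2)⁻¹ * t) z (hc.mul continuous_id).continuousOn,
      cfc_mul _ (fun t => t) z hc.continuousOn (by fun_prop), cfc_id' ℝ z]
  rw [hF' x hx, hF y hy]
  set P := cfc (fun t : ℝ => (1 + t ^ 2)⁻¹) x
  set Q := cfc (fun t : ℝ => (1 + t ^ 2)⁻¹) y
  have e1 : P * x = P * x * ((1 + y * y) * Q) := by rw [h2 y hy, mul_one]
  have e2 : y * Q = (P * (1 + x * x)) * (y * Q) := by rw [h1 x hx, one_mul]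
  have e3 : P * x - y * Q = P * ((x - y) * Q) + P * x * ((y - x) * (y * Q)) := by
    conv_lhs => rw [e1, e2]
    noncomm_ring
  rw [← smul_sub, e3]
  simp only [smul_add, smul_mul_assoc, mul_smul_comm, smul_smul]
  norm_num

variable {A : Type*} [NonUnitalCStarAlgebra A]
  {H : Type*} [NormedAddCommGroup H] [InnerProductSpace ℂ H] [CompleteSpace H]

theorem norm_representation_le (π : A →⋆ₙₐ[ℂ] (H →L[ℂ] H)) (a : A) : ‖π a‖ ≤ ‖a‖ :=
  NonUnitalStarAlgHom.norm_apply_le π a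

theorem continuous_representation (π : A →⋆ₙₐ[ℂ] (H →L[ℂ] H)) : Continuous π :=
  AddMonoidHomClass.continuous_of_bound π 1 fun a => by
    rw [one_mul]
    exact norm_representation_le π a

/-- Kaplansky density for the self-adjoint part of an irreducible representation. -/
theorem IsIrreducible.exists_selfAdjoint_approx_norm_le_one {π : A →⋆ₙₐ[ℂ] (H →L[ℂ] H)}
    (hπ : IsIrreducible π) {ι : Type*} [Fintype ι] (v : ι → H) (S : H →L[ℂ] H)
    (hS : IsSelfAdjoint S) (hS1 : ‖S‖ ≤ 1) {ε : ℝ} (hε : 0 < ε) :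
    ∃ h : A, IsSelfAdjoint h ∧ ‖h‖ ≤ 1 ∧ ∀ i, ‖π h (v i) - S (v i)‖ < ε := by
  have hc : Continuous fun t : ℝ => (1 + t ^ 2)⁻¹ :=
    Continuous.inv₀ (by fun_prop) fun t => by positivity
  have hf0 : kaplanskyFun 0 = 0 := by simp [kaplanskyFun]
  set y := cfc kaplanskyInv S with hy
  have hysa : IsSelfAdjoint y := cfc_predicate _ _
  have hyS : cfc kaplanskyFun y = S := by
    rw [hy, ← cfc_comp' kaplanskyFun kaplanskyInv S continuous_kaplanskyFun.continuousOn
      continuous_kaplanskyInv.continuousOn]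
    conv_rhs => rw [← cfc_id' ℝ S]
    refine cfc_congr fun s hs => kaplanskyFun_kaplanskyInv ?_
    refine (spectrum.norm_le_norm_mul_of_mem hs).trans ?_
    exact mul_le_one₀ hS1 (norm_nonneg _) ContinuousLinearMap.norm_id_le
  set Q := cfc (fun t : ℝ => (1 + t ^ 2)⁻¹) y with hQ
  -- These are the vectors met by `π k - y` in `cfc_kaplanskyFun_sub`; the weights `2` and `1 / 2`
  -- give a total below `5ε / 6`.
  obtain ⟨k, hk, hkv⟩ := hπ.exists_selfAdjoint_approx
    (Sum.elim (fun i => Q (v i)) (fun i => S (v i))) y hysa (ε := ε / 3) (by positivity)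
  refine ⟨cfcₙ kaplanskyFun k, cfcₙ_predicate _ _, norm_cfcₙ_le fun t _ => abs_kaplanskyFun_le t,
    fun i => ?_⟩
  have hx : IsSelfAdjoint (π k) := hk.map π
  have hmap : π (cfcₙ kaplanskyFun k) = cfc kaplanskyFun (π k) := by
    rw [NonUnitalStarAlgHomClass.map_cfcₙ π kaplanskyFun k
      continuous_kaplanskyFun.continuousOn hf0 (continuous_representation π) hk hx,
      cfcₙ_eq_cfc continuous_kaplanskyFun.continuousOn hf0]
  have hid := cfc_kaplanskyFun_sub (π k) y hx hysa
  rw [hyS, ← hmap, ← hQ] at hid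
  have hv := DFunLike.congr_fun hid (v i)
  rw [sub_apply] at hv
  rw [hv]
  have n1 : ‖cfc (fun t : ℝ => (1 + t ^ 2)⁻¹) (π k)‖ ≤ 1 := by
    refine norm_cfc_le zero_le_one fun t _ => ?_
    rw [Real.norm_eq_abs, abs_inv, abs_of_pos (by positivity)]
    exact inv_le_one_of_one_le₀ (by nlinarith [sq_nonneg t])
  have n2 : ‖π (cfcₙ kaplanskyFun k)‖ ≤ 1 := by
    rw [hmap]
    exact norm_cfc_le zero_le_one fun t _ => abs_kaplanskyFun_le t
  have m1 : ‖(π k - y) (Q (v i))‖ < ε / 3 := by simpa using hkv (Sum.inl i)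
  have m2 : ‖(y - π k) (S (v i))‖ < ε / 3 := by
    rw [← norm_neg, ← neg_apply, neg_sub]
    simpa using hkv (Sum.inr i)
  have k1 : ‖cfc (fun t : ℝ => (1 + t ^ 2)⁻¹) (π k) ((π k - y) (Q (v i)))‖ < ε / 3 :=
    (ContinuousLinearMap.le_of_opNorm_le _ n1 _).trans_lt (by rwa [one_mul])
  have k2 : ‖π (cfcₙ kaplanskyFun k) ((y - π k) (S (v i)))‖ < ε / 3 :=
    (ContinuousLinearMap.le_of_opNorm_le _ n2 _).trans_lt (by rwa [one_mul])
  calc _ = ‖(2 : ℝ) • cfc (fun t : ℝ => (1 + t ^ 2)⁻¹) (π k) ((π k - y) (Q (v i)))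
        + (1 / 2 : ℝ) • π (cfcₙ kaplanskyFun k) ((y - π k) (S (v i)))‖ := rfl
    _ ≤ 2 * ‖cfc (fun t : ℝ => (1 + t ^ 2)⁻¹) (π k) ((π k - y) (Q (v i)))‖
        + 1 / 2 * ‖π (cfcₙ kaplanskyFun k) ((y - π k) (S (v i)))‖ := by
        refine (norm_add_le _ _).trans_eq ?_
        rw [norm_smul, norm_smul]
        norm_num
    _ < ε := by linarith

end Kaplansky

/-! ### Kadison transitivity. -/

section Transitivity

variable {A : Type*} [NonUnitalCStarAlgebra A]
  {H : Type*} [NormedAddCommGroup H] [InnerProductSpace ℂ H] [CompleteSpace H]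
  {π : A →⋆ₙₐ[ℂ] (H →L[ℂ] H)}

theorem IsIrreducible.exists_selfAdjoint_approx_norm_le (hπ : IsIrreducible π)
    {ι : Type*} [Fintype ι] (v : ι → H) (S : H →L[ℂ] H) (hS : IsSelfAdjoint S) {r : ℝ}
    (hr : 0 < r) (hSr : ‖S‖ ≤ r) {ε : ℝ} (hε : 0 < ε) :
    ∃ h : A, IsSelfAdjoint h ∧ ‖h‖ ≤ r ∧ ∀ i, ‖π h (v i) - S (v i)‖ < ε := by
  have hc : star (r : ℂ) = r := by simp
  have hn : ‖(r : ℂ)‖ = r := by simp [abs_of_pos hr]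
  have hr0 : (r : ℂ) ≠ 0 := by exact_mod_cast hr.ne'
  obtain ⟨h, hh, hh1, hv⟩ := hπ.exists_selfAdjoint_approx_norm_le_one v ((r : ℂ)⁻¹ • S)
    (by
      change star _ = _
      rw [star_smul, hS.star_eq, star_inv₀, hc])
    (by
      rw [norm_smul, norm_inv, hn, inv_mul_le_one₀ hr]
      exact hSr) (ε := ε / r) (by positivity)
  refine ⟨(r : ℂ) • h, ?_, ?_, fun i => ?_⟩
  · change star _ = _
    rw [star_smul, hh.star_eq, hc]
  · rw [norm_smul, hn]
    exact mul_le_of_le_one_right hr.le hh1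
  · have h1 : π ((r : ℂ) • h) (v i) - S (v i) =
        (r : ℂ) • (π h (v i) - ((r : ℂ)⁻¹ • S) (v i)) := by
      rw [smul_sub, map_smul, smul_apply, smul_apply, smul_inv_smul₀ hr0]
    rw [h1, norm_smul, hn, mul_comm, ← lt_div_iff₀ hr]
    exact hv i

/-- One step of successive approximation: the error on the finite family `v` is again realised by a
self-adjoint operator, of half the norm bound, so the step can be repeated. -/
theorem IsIrreducible.exists_selfAdjoint_halving (hπ : IsIrreducible π)
    {ι : Type*} [Fintype ι] {v : ι → H} (hv : Orthonormal ℂ v) (S : H →L[ℂ] H)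
    (hS : IsSelfAdjoint S) {r : ℝ} (hr : 0 < r) (hSr : ‖S‖ ≤ r) :
    ∃ (h : A) (S' : H →L[ℂ] H), IsSelfAdjoint h ∧ IsSelfAdjoint S' ∧ ‖h‖ ≤ r ∧ ‖S'‖ ≤ r / 2 ∧
      ∀ i, S' (v i) = S (v i) - π h (v i) := by
  classical
  set n : ℝ := (Fintype.card ι : ℝ) with hn
  have hn0 : 0 ≤ n := by positivity
  -- With tolerance `τ`, the corrected operator has norm at most `nτ + nτ + n²τ = n(n + 2)τ`, which
  -- this choice keeps below `r / 2`.
  obtain ⟨h, hh, hhr, hap⟩ := hπ.exists_selfAdjoint_approx_norm_le v S hS hr hSr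
    (ε := r / (2 * (n + 1) * (n + 2))) (by positivity)
  set R := S - π h with hR
  have hRsa : IsSelfAdjoint R := hS.sub (hh.map π)
  let P : H →L[ℂ] H := ∑ i, InnerProductSpace.rankOne ℂ (v i) (v i)
  have hPsa : star P = P := by
    rw [star_sum]
    refine Finset.sum_congr rfl fun i _ => ?_
    rw [ContinuousLinearMap.star_eq_adjoint, InnerProductSpace.adjoint_rankOne]
  have hPv : ∀ i, P (v i) = v i := by
    intro i
    simp only [P, sum_apply, InnerProductSpace.rankOne_apply]
    rw [Finset.sum_eq_single i]
    · rw [inner_self_eq_norm_sq_to_K, hv.1 i]; simp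
    · intro j _ hj
      rw [hv.2 hj, zero_smul]
    · simp
  have hPn : ‖P‖ ≤ n := by
    refine (norm_sum_le _ _).trans ?_
    simp [InnerProductSpace.norm_rankOne, hv.1, hn]
  have hRP : ‖R * P‖ ≤ n * (r / (2 * (n + 1) * (n + 2))) := by
    rw [Finset.mul_sum]
    refine (norm_sum_le _ _).trans ?_
    have : ∀ i ∈ Finset.univ, ‖R * InnerProductSpace.rankOne ℂ (v i) (v i)‖
        ≤ r / (2 * (n + 1) * (n + 2)) := by
      intro i _
      have h1 : R * InnerProductSpace.rankOne ℂ (v i) (v i)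
          = InnerProductSpace.rankOne ℂ (R (v i)) (v i) := by
        ext x
        simp [InnerProductSpace.rankOne_apply]
      rw [h1, InnerProductSpace.norm_rankOne, hv.1 i, mul_one, hR, sub_apply, ← norm_neg, neg_sub]
      exact (hap i).le
    refine (Finset.sum_le_card_nsmul _ _ _ this).trans_eq ?_
    rw [nsmul_eq_mul, hn, Finset.card_univ]
  have hPR : ‖P * R‖ ≤ n * (r / (2 * (n + 1) * (n + 2))) := by
    have : P * R = star (R * P) := by rw [star_mul, hPsa, hRsa.star_eq]
    rw [this, norm_star]
    exact hRP
  -- `R * P` has the right values on `v` but is not self-adjoint; the added terms symmetrise it and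
  -- cancel on the range of `P`.
  refine ⟨h, R * P + P * R - P * (R * P), hh, ?_, hhr, ?_, fun i => ?_⟩
  · change star _ = _
    simp only [star_sub, star_add, star_mul, hPsa, hRsa.star_eq]
    noncomm_ring
  · have h3 : ‖P * (R * P)‖ ≤ n * (n * (r / (2 * (n + 1) * (n + 2)))) :=
      (norm_mul_le _ _).trans (mul_le_mul hPn hRP (norm_nonneg _) hn0)
    have h4 : ‖R * P + P * R - P * (R * P)‖ ≤ ‖R * P‖ + ‖P * R‖ + ‖P * (R * P)‖ :=
      (norm_sub_le _ _).trans (add_le_add_left (norm_add_le _ _) _)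
    have h5 : n * (n + 2) * (r / (2 * (n + 1) * (n + 2))) ≤ r / 2 := by
      rw [mul_div_assoc', div_le_div_iff₀ (by positivity) (by positivity)]
      nlinarith [mul_nonneg hr.le (by positivity : 0 ≤ n + 2)]
    nlinarith
  · simp [hPv, hR]

/-- Kadison's transitivity theorem for self-adjoint operators and orthonormal vectors. -/
theorem IsIrreducible.exists_selfAdjoint_apply_eq (hπ : IsIrreducible π)
    {ι : Type*} [Fintype ι] {v : ι → H} (hv : Orthonormal ℂ v) (S : H →L[ℂ] H)
    (hS : IsSelfAdjoint S) : ∃ h : A, IsSelfAdjoint h ∧ ∀ i, π h (v i) = S (v i) := by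
  have step := fun (S : H →L[ℂ] H) (r : ℝ) (hS : IsSelfAdjoint S ∧ 0 < r ∧ ‖S‖ ≤ r) =>
    hπ.exists_selfAdjoint_halving hv S hS.1 hS.2.1 hS.2.2
  choose! g S' hg hS' hgr hS'r hgv using step
  set r : ℝ := ‖S‖ + 1 with hrdef
  have hr : 0 < r := by positivity
  -- `T n` is the error after `n` corrections, so the partial sums of `π (h n)` telescope on `v`.
  let T : ℕ → H →L[ℂ] H := fun n => Nat.rec S (fun k X => S' X (r / 2 ^ k)) n
  have hT : ∀ n, IsSelfAdjoint (T n) ∧ 0 < r / 2 ^ n ∧ ‖T n‖ ≤ r / 2 ^ n := by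
    intro n
    induction n with
    | zero => exact ⟨hS, by positivity, by simp [T, hrdef]⟩
    | succ k ih =>
      refine ⟨hS' _ _ ih, by positivity, ?_⟩
      refine (hS'r _ _ ih).trans_eq ?_
      rw [pow_succ, div_div]
  let h : ℕ → A := fun n => g (T n) (r / 2 ^ n)
  have hgeo : Summable fun n : ℕ => r / 2 ^ n := by
    simpa [div_eq_mul_inv] using (summable_geometric_two.mul_left r)
  have hsum : Summable h := Summable.of_norm_bounded hgeo fun n => hgr _ _ (hT n)
  refine ⟨∑' n, h n, ?_, fun i => ?_⟩
  · change star _ = _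
    rw [tsum_star]
    exact tsum_congr fun n => hg _ _ (hT n)
  · have h1 : HasSum (fun n => π (h n) (v i)) (π (∑' n, h n) (v i)) := by
      have hcont : Continuous fun a : A => π a (v i) :=
        (continuous_representation π).clm_apply continuous_const
      exact hsum.hasSum.map
        (⟨⟨fun a : A => π a (v i), by simp⟩, fun a b => by simp⟩ : A →+ H) hcont
    have h2 : ∀ N, ∑ n ∈ Finset.range N, π (h n) (v i) = S (v i) - T N (v i) := by
      intro N
      have : ∀ n, π (h n) (v i) = T n (v i) - T (n + 1) (v i) := by
        intro n
        have := hgv _ _ (hT n) i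
        change T (n + 1) (v i) = _ at this
        rw [this, sub_sub_cancel]
      rw [Finset.sum_congr rfl fun n _ => this n, Finset.sum_range_sub' fun n => T n (v i)]
      rfl
    have h3 : Tendsto (fun N => T N (v i)) atTop (𝓝 0) := by
      refine squeeze_zero_norm (fun N => ?_) hgeo.tendsto_atTop_zero
      have := ContinuousLinearMap.le_of_opNorm_le _ (hT N).2.2 (v i)
      rwa [hv.1 i, mul_one] at this
    refine tendsto_nhds_unique h1.tendsto_sum_nat ?_
    simp_rw [h2]
    simpa using tendsto_const_nhds.sub h3


theorem exp_apply_of_apply_eq_smul (T : H →L[ℂ] H) (z : ℂ) (x : H)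
    (h : T x = z • x) : NormedSpace.exp T x = Complex.exp z • x := by
  have hpow : ∀ n : ℕ, (T ^ n) x = z ^ n • x := by
    intro n
    induction n with
    | zero => simp
    | succ k ih => rw [pow_succ, mul_apply_eq_comp, h, map_smul, ih, smul_smul, pow_succ,
        mul_comm]
  have h1 := (NormedSpace.exp_series_hasSum_exp' (𝕂 := ℂ) T).mapL
    (ContinuousLinearMap.apply ℂ H x)
  have h2 := (NormedSpace.exp_series_hasSum_exp' (𝕂 := ℂ) z).smul_const x
  rw [← Complex.exp_eq_exp_ℂ] at h2
  refine h1.unique ?_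
  convert h2 using 2 with n
  simp [hpow, smul_smul]

/-- Kadison's transitivity theorem for two unit vectors, with a unitary of the form `exp (i h)`. -/
theorem IsIrreducible.exists_exp_apply_eq_smul (hπ : IsIrreducible π) {ξ η : H} (hξ : ‖ξ‖ = 1)
    (hη : ‖η‖ = 1) : ∃ (h : A) (c : ℂ), IsSelfAdjoint h ∧ ‖c‖ = 1 ∧
      NormedSpace.exp (Complex.I • π h) ξ = c • η := by
  -- The phase makes the inner product real and nonnegative, so that `ξ - η'` and `ξ + η'` are
  -- orthogonal and `ξ + η' ≠ 0`.
  obtain ⟨c, hc, hcr⟩ : ∃ c : ℂ, ‖c‖ = 1 ∧ inner ℂ ξ (c • η) = (‖inner ℂ ξ η‖ : ℂ) := by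
    by_cases hz : inner ℂ ξ η = 0
    · exact ⟨1, by simp, by simp [hz]⟩
    · refine ⟨(starRingEnd ℂ) (inner ℂ ξ η) / ‖inner ℂ ξ η‖, ?_, ?_⟩
      · rw [norm_div, RCLike.norm_conj, Complex.norm_real, norm_norm, div_self]
        simpa using hz
      · have : (‖inner ℂ ξ η‖ : ℂ) ≠ 0 := by simpa using hz
        rw [inner_smul_right, div_mul_eq_mul_div, Complex.conj_mul', sq, mul_div_assoc,
          div_self this, mul_one]
  obtain ⟨η', hη'⟩ : ∃ η' : H, η' = c • η := ⟨_, rfl⟩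
  have hη'1 : ‖η'‖ = 1 := by rw [hη', norm_smul, hc, hη, mul_one]
  rw [← hη'] at hcr
  have hcr' : inner ℂ η' ξ = (‖inner ℂ ξ η‖ : ℂ) := by
    rw [← inner_conj_symm, hcr, Complex.conj_ofReal]
  suffices hs : ∃ h : A, IsSelfAdjoint h ∧ NormedSpace.exp (Complex.I • π h) ξ = η' by
    obtain ⟨h, hh, he⟩ := hs
    exact ⟨h, c, hh, hc, by rw [he, hη']⟩
  by_cases hv : ξ - η' = 0
  · refine ⟨0, .zero _, ?_⟩
    simpa using sub_eq_zero.mp hv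
  have hw : ξ + η' ≠ 0 := by
    intro hw
    have h1 : inner ℂ ξ (ξ + η') = 0 := by rw [hw, inner_zero_right]
    rw [inner_add_right, hcr, inner_self_eq_norm_sq_to_K, hξ] at h1
    have h2 : (1 + ‖inner ℂ ξ η‖ : ℝ) = 0 := by
      have := congrArg Complex.re h1
      simpa using this
    linarith [norm_nonneg (inner ℂ ξ η)]
  have horth : inner ℂ (ξ - η') (ξ + η') = 0 := by
    rw [inner_add_right, inner_sub_left, inner_sub_left, hcr, hcr', inner_self_eq_norm_sq_to_K,
      inner_self_eq_norm_sq_to_K, hξ, hη'1]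
    ring
  let e : Fin 2 → H := ![(‖ξ - η'‖ : ℂ)⁻¹ • (ξ - η'), (‖ξ + η'‖ : ℂ)⁻¹ • (ξ + η')]
  have hunit : ∀ x : H, x ≠ 0 → ‖(‖x‖ : ℂ)⁻¹ • x‖ = 1 := fun x hx => by simp [norm_smul, hx]
  have he0 : ‖e 0‖ = 1 := hunit _ hv
  have he1 : ‖e 1‖ = 1 := hunit _ hw
  have he01 : inner ℂ (e 0) (e 1) = 0 := by
    change inner ℂ (_ • (ξ - η')) (_ • (ξ + η')) = 0
    rw [inner_smul_left, inner_smul_right, horth, mul_zero, mul_zero]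
  have he : Orthonormal ℂ e := by
    refine ⟨fun i => ?_, fun i j hij => ?_⟩
    · fin_cases i
      · exact he0
      · exact he1
    · fin_cases i <;> fin_cases j
      · exact absurd rfl hij
      · exact he01
      · exact inner_eq_zero_symm.mp he01
      · exact absurd rfl hij
  -- With `h` acting as `π` times the projection onto `ξ - η'`, the exponential is the reflection
  -- that negates `ξ - η'` and fixes `ξ + η'`, hence sends `ξ` to `η'`.
  obtain ⟨h, hh, hhe⟩ := hπ.exists_selfAdjoint_apply_eq he
    ((Real.pi : ℂ) • InnerProductSpace.rankOne ℂ (e 0) (e 0)) (by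
      change star _ = _
      rw [star_smul, ContinuousLinearMap.star_eq_adjoint, InnerProductSpace.adjoint_rankOne]
      simp)
  have h0 : π h (e 0) = (Real.pi : ℂ) • e 0 := by
    rw [hhe, smul_apply, InnerProductSpace.rankOne_apply, inner_self_eq_norm_sq_to_K, he0]
    simp
  have h1 : π h (e 1) = 0 := by
    rw [hhe, smul_apply, InnerProductSpace.rankOne_apply, he01]
    simp
  have hv0 : ξ - η' = (‖ξ - η'‖ : ℂ) • e 0 := by
    have : (‖ξ - η'‖ : ℂ) ≠ 0 := by simpa using hv
    exact (smul_inv_smul₀ this _).symm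
  have hw1 : ξ + η' = (‖ξ + η'‖ : ℂ) • e 1 := by
    have : (‖ξ + η'‖ : ℂ) ≠ 0 := by simpa using hw
    exact (smul_inv_smul₀ this _).symm
  have k0 : NormedSpace.exp (Complex.I • π h) (ξ - η') = -(ξ - η') := by
    rw [exp_apply_of_apply_eq_smul _ (Real.pi * Complex.I), Complex.exp_pi_mul_I, neg_one_smul]
    rw [smul_apply, hv0, map_smul, h0, smul_smul, smul_smul, smul_smul]
    congr 1
    ring
  have k1 : NormedSpace.exp (Complex.I • π h) (ξ + η') = ξ + η' := by
    rw [exp_apply_of_apply_eq_smul _ 0, Complex.exp_zero, one_smul]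
    rw [smul_apply, hw1, map_smul, h1]
    simp
  refine ⟨h, hh, ?_⟩
  have hξ2 : ξ = (2 : ℂ)⁻¹ • ((ξ - η') + (ξ + η')) := by
    rw [show (ξ - η') + (ξ + η') = (2 : ℂ) • ξ by rw [two_smul]; abel, inv_smul_smul₀ two_ne_zero]
  conv_lhs => rw [hξ2]
  rw [map_smul, map_add, k0, k1,
    show -(ξ - η') + (ξ + η') = (2 : ℂ) • η' by rw [two_smul]; abel, inv_smul_smul₀ two_ne_zero]

end Transitivity

/-! ### GNS representations and irreducibility for pure states. -/

section GNS

variable {A : Type*} [NonUnitalCStarAlgebra A] [PartialOrder A] [StarOrderedRing A]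

/-- The class of `a` in the GNS space. -/
noncomputable def gnsMk (f : A →ₚ[ℂ] ℂ) : A →ₗ[ℂ] f.GNS :=
  (UniformSpace.Completion.toComplₗᵢ (𝕜 := ℂ) (E := f.PreGNS)).toLinearMap ∘ₗ
    f.toPreGNS.toLinearMap

theorem gnsMk_apply (f : A →ₚ[ℂ] ℂ) (a : A) : gnsMk f a = (f.toPreGNS a : f.GNS) := rfl

theorem inner_gnsMk (f : A →ₚ[ℂ] ℂ) (a b : A) :
    inner ℂ (gnsMk f a) (gnsMk f b) = f (star a * b) := by
  rw [gnsMk_apply, gnsMk_apply, UniformSpace.Completion.inner_coe,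
    PositiveLinearMap.preGNS_inner_def]
  rfl

theorem gns_apply_gnsMk (f : A →ₚ[ℂ] ℂ) (a b : A) :
    f.gnsNonUnitalStarAlgHom a (gnsMk f b) = gnsMk f (a * b) := by
  rw [gnsMk_apply, PositiveLinearMap.gnsNonUnitalStarAlgHom_apply_coe]
  rfl

theorem denseRange_gnsMk (f : A →ₚ[ℂ] ℂ) : DenseRange (gnsMk f) := by
  have := (UniformSpace.Completion.denseRange_coe (α := f.PreGNS))
  exact this.comp f.toPreGNS.surjective.denseRange
    (UniformSpace.Completion.continuous_coe (α := f.PreGNS))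

theorem IsState.norm_apply_le {f : A →ₚ[ℂ] ℂ} (hf : IsState f) (a : A) : ‖f a‖ ≤ ‖a‖ := by
  have := ContinuousLinearMap.le_opNorm (⟨f.toLinearMap, map_continuous f⟩ : A →L[ℂ] ℂ) a
  unfold IsState at hf
  rw [hf, one_mul] at this
  exact this

theorem norm_gnsMk_sq (f : A →ₚ[ℂ] ℂ) (a : A) : ‖gnsMk f a‖ ^ 2 = ‖f (star a * a)‖ := by
  have := inner_gnsMk f a a
  rw [inner_self_eq_norm_sq_to_K] at this
  rw [← this]
  simp

theorem IsState.norm_gnsMk_le {f : A →ₚ[ℂ] ℂ} (hf : IsState f) (a : A) : ‖gnsMk f a‖ ≤ ‖a‖ := by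
  have h := hf.norm_apply_le (star a * a)
  rw [← norm_gnsMk_sq, CStarRing.norm_star_mul_self, ← sq] at h
  exact le_of_sq_le_sq h (norm_nonneg _)

/-- The Cauchy-Schwarz inequality `|f(a)|² ≤ f(a*a)` for a state. -/
theorem IsState.norm_apply_le_norm_gnsMk {f : A →ₚ[ℂ] ℂ} (hf : IsState f) (a : A) :
    ‖f a‖ ≤ ‖gnsMk f a‖ := by
  have hl := CStarAlgebra.increasingApproximateUnit A
  have h1 : Tendsto (fun e => f (e * a)) (CStarAlgebra.approximateUnit A) (𝓝 (f a)) :=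
    ((map_continuous f).tendsto a).comp (hl.tendsto_mul_right a)
  refine le_of_tendsto h1.norm ?_
  filter_upwards [hl.eventually_star_eq, hl.eventually_norm] with e he hn
  calc ‖f (e * a)‖ = ‖inner ℂ (gnsMk f e) (gnsMk f a)‖ := by rw [inner_gnsMk, he]
    _ ≤ ‖gnsMk f e‖ * ‖gnsMk f a‖ := norm_inner_le_norm _ _
    _ ≤ 1 * ‖gnsMk f a‖ := by
        gcongr
        exact (hf.norm_gnsMk_le e).trans hn
    _ = _ := one_mul _

/-- A state is a vector state of its GNS representation, at a cyclic unit vector. -/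
theorem IsState.exists_cyclic {f : A →ₚ[ℂ] ℂ} (hf : IsState f) :
    ∃ ξ : f.GNS, ‖ξ‖ = 1 ∧ (∀ a, f.gnsNonUnitalStarAlgHom a ξ = gnsMk f a) ∧
      ∀ a, f a = inner ℂ ξ (f.gnsNonUnitalStarAlgHom a ξ) := by
  -- There may be no unit whose class could serve as cyclic vector. Cauchy-Schwarz makes `gnsMk f a
  -- ↦ f a` bounded, and its Riesz vector takes that role.
  let L : f.GNS →L[ℂ] ℂ := f.toLinearMap.extendOfNorm (gnsMk f)
  have hL : ∀ a, L (gnsMk f a) = f a := fun a =>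
    LinearMap.extendOfNorm_eq (denseRange_gnsMk f)
      ⟨1, fun x => by rw [one_mul]; exact hf.norm_apply_le_norm_gnsMk x⟩ a
  obtain ⟨ξ, hξ⟩ := (InnerProductSpace.toDual ℂ f.GNS).surjective L
  have hin : ∀ a, inner ℂ ξ (gnsMk f a) = f a := by
    intro a
    rw [← InnerProductSpace.toDual_apply_apply, hξ, hL]
  have hcyc : ∀ a, f.gnsNonUnitalStarAlgHom a ξ = gnsMk f a := by
    intro a
    rw [← sub_eq_zero]
    refine (denseRange_gnsMk f).eq_zero_of_inner_left ℂ ?_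
    intro b
    have := inner_map_star f.gnsNonUnitalStarAlgHom (star a) ξ (gnsMk f b)
    rw [star_star] at this
    rw [inner_sub_left, this, gns_apply_gnsMk, hin, inner_gnsMk, sub_self]
  have hfa : ∀ a, f a = inner ℂ ξ (f.gnsNonUnitalStarAlgHom a ξ) := fun a => by
    rw [hcyc, hin]
  refine ⟨ξ, le_antisymm ?_ ?_, hcyc, hfa⟩
  · have h1 : ‖L‖ ≤ 1 := by
      refine ContinuousLinearMap.opNorm_le_bound _ zero_le_one fun x => ?_
      induction x using (denseRange_gnsMk f).induction_on with
      | hp => exact isClosed_le (by fun_prop) (by fun_prop)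
      | ih a =>
        rw [hL, one_mul]
        exact hf.norm_apply_le_norm_gnsMk a
    rw [← (InnerProductSpace.toDual ℂ f.GNS).norm_map ξ, hξ]
    exact h1
  · have h1 : ‖(⟨f.toLinearMap, map_continuous f⟩ : A →L[ℂ] ℂ)‖ ≤ ‖ξ‖ ^ 2 := by
      refine ContinuousLinearMap.opNorm_le_bound _ (by positivity) fun a => ?_
      change ‖f a‖ ≤ _
      rw [hfa]
      refine (norm_inner_le_norm _ _).trans ?_
      have h2 := ContinuousLinearMap.le_of_opNorm_le _
        (norm_representation_le f.gnsNonUnitalStarAlgHom a) ξ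
      nlinarith [norm_nonneg ξ]
    unfold IsState at hf
    rw [hf] at h1
    nlinarith [norm_nonneg ξ]

variable {H : Type*} [NormedAddCommGroup H] [InnerProductSpace ℂ H] [CompleteSpace H]

/-- A representation with a cyclic vector that implements a pure state is irreducible. -/
theorem IsPureState.isIrreducible_of_cyclic {f : A →ₚ[ℂ] ℂ} (hf : IsPureState f)
    {π : A →⋆ₙₐ[ℂ] (H →L[ℂ] H)} {ξ : H} (hd : DenseRange fun a => π a ξ)
    (hfa : ∀ a, f a = inner ℂ ξ (π a ξ)) : IsIrreducible π := by
  have hcomm_star : ∀ T : H →L[ℂ] H, (∀ a, T * π a = π a * T) →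
      ∀ a, star T * π a = π a * star T := by
    intro T hT a
    have := congrArg star (hT (star a))
    rw [star_mul, star_mul, map_star, star_star] at this
    exact this.symm
  have hpos : ∀ T : H →L[ℂ] H, 0 ≤ T → (∀ a, T * π a = π a * T) →
      ∀ a : A, 0 ≤ a → 0 ≤ inner ℂ ξ (π a (T ξ)) := by
    intro T hT0 hT a ha
    obtain ⟨b, rfl⟩ := CStarAlgebra.nonneg_iff_eq_star_mul_self.mp ha
    have h1 : π (star b * b) (T ξ) = π (star b) (T (π b ξ)) := by
      rw [map_mul, mul_apply_eq_comp]
      have := DFunLike.congr_fun (hT b) ξ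
      rw [mul_apply_eq_comp, mul_apply_eq_comp] at this
      rw [← this]
    have h2 := inner_map_star π (star b) ξ (T (π b ξ))
    rw [star_star] at h2
    rw [h1, ← h2]
    exact ((ContinuousLinearMap.nonneg_iff_isPositive T).mp hT0).inner_nonneg_right _
  have hunit : ∀ T : H →L[ℂ] H, 0 ≤ T → T ≤ 1 → (∀ a, T * π a = π a * T) →
      ∃ c : ℂ, T = c • 1 := by
    intro T hT0 hT1 hT
    -- A commuting `0 ≤ T ≤ 1` cuts out a functional below `f`. Purity makes it `t f`, and cyclicity
    -- of `ξ` turns this into `T = t`.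
    let ψ₀ : A →ₗ[ℂ] ℂ :=
      { toFun := fun a => inner ℂ ξ (π a (T ξ))
        map_add' := fun a b => by simp
        map_smul' := fun c a => by simp }
    let ψ : A →ₚ[ℂ] ℂ := PositiveLinearMap.mk₀ ψ₀ (hpos T hT0 hT)
    have hψ : ∀ a, ψ a = inner ℂ ξ (π a (T ξ)) := fun a => rfl
    obtain ⟨t, -, -, ht⟩ := hf.2 ψ (by
      intro a ha
      have := hpos (1 - T) (sub_nonneg.mpr hT1) (fun b => by
        rw [sub_mul, mul_sub, hT, one_mul, mul_one]) a ha
      rw [sub_apply, map_sub, inner_sub_right, one_apply_eq_self, ← hfa] at this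
      rw [hψ]
      exact sub_nonneg.mp this)
    refine ⟨t, ?_⟩
    refine ContinuousLinearMap.ext fun x => ?_
    induction x using hd.induction_on with
    | hp => exact isClosed_eq (by fun_prop) (by fun_prop)
    | ih b =>
      rw [← sub_eq_zero]
      refine hd.eq_zero_of_inner_left ℂ ?_
      intro a
      rw [← inner_conj_symm, map_eq_zero]
      have h1 : inner ℂ (π a ξ) (T (π b ξ)) = ψ (star a * b) := by
        have h2 := DFunLike.congr_fun (hT b) ξ
        rw [mul_apply_eq_comp, mul_apply_eq_comp] at h2
        have h3 := inner_map_star π (star a) ξ (π b (T ξ))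
        rw [star_star] at h3
        rw [h2, h3, hψ, map_mul, mul_apply_eq_comp]
      have h4 := inner_map_star π (star a) ξ (π b ξ)
      rw [star_star] at h4
      rw [inner_sub_right, h1, ht, smul_apply, inner_smul_right, one_apply_eq_self, h4, hfa,
        map_mul, mul_apply_eq_comp, sub_self]
  have hsa : ∀ T : H →L[ℂ] H, IsSelfAdjoint T → (∀ a, T * π a = π a * T) →
      ∃ c : ℂ, T = c • 1 := by
    intro T hTsa hT
    -- The affine map `T ↦ (T + M) / (2M)` brings a self-adjoint operator between `0` and `1`.
    set M : ℝ := ‖T‖ + 1 with hM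
    have hM0 : 0 < M := by positivity
    have hle : T ≤ algebraMap ℝ _ M := hTsa.le_algebraMap_norm_self.trans
      (by gcongr; linarith)
    have hge : -algebraMap ℝ _ M ≤ T := (neg_le_neg (by gcongr; linarith)).trans
      hTsa.neg_algebraMap_norm_le_self
    obtain ⟨c, hc⟩ := hunit ((1 / (2 * M) : ℝ) • (T + algebraMap ℝ _ M))
      (smul_nonneg (by positivity) (by
        rw [← neg_le_iff_add_nonneg]; exact hge))
      (by
        have : (1 : H →L[ℂ] H) = (1 / (2 * M) : ℝ) •
            (algebraMap ℝ _ M + algebraMap ℝ _ M) := by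
          rw [← map_add, Algebra.algebraMap_eq_smul_one, smul_smul]
          rw [show 1 / (2 * M) * (M + M) = 1 by field_simp; norm_num, one_smul]
        rw [this]
        gcongr)
      (fun a => by
        rw [smul_mul_assoc, mul_smul_comm, add_mul, mul_add (π a), hT, Algebra.commutes])
    refine ⟨2 * M * c - M, ?_⟩
    have h1 : T = (2 * M : ℝ) • ((1 / (2 * M) : ℝ) • (T + algebraMap ℝ _ M))
        - algebraMap ℝ _ M := by
      rw [smul_smul, show 2 * M * (1 / (2 * M)) = 1 by field_simp, one_smul, add_sub_cancel_right]
    have h2 : ∀ (r : ℝ) (X : H →L[ℂ] H), r • X = (r : ℂ) • X := fun r X =>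
      (Complex.coe_smul r X).symm
    rw [h1, hc, Algebra.algebraMap_eq_smul_one, h2, h2, smul_smul, ← sub_smul]
    push_cast
    rfl
  constructor
  · intro z hz
    refine hd.eq_zero_of_inner_left ℂ ?_
    intro a
    have := inner_map_star π (star a) z ξ
    rw [star_star] at this
    have h0 : inner ℂ z (π a ξ) = 0 := by
      rw [← inner_map_star, hz, inner_zero_left]
    exact h0
  · intro T hT
    obtain ⟨c, hc⟩ := hsa (realPart T) (realPart T).2 (fun a => by
      rw [realPart_apply_coe, smul_mul_assoc, mul_smul_comm, add_mul, mul_add, hT,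
        hcomm_star T hT])
    obtain ⟨d, hd⟩ := hsa (imaginaryPart T) (imaginaryPart T).2 (fun a => by
      rw [imaginaryPart_apply_coe]
      simp only [smul_mul_assoc, mul_smul_comm, sub_mul, mul_sub, hT, hcomm_star T hT])
    refine ⟨c + Complex.I * d, ?_⟩
    rw [← realPart_add_I_smul_imaginaryPart T, hc, hd, add_smul, smul_smul]

/-- The GNS representation of a pure state is irreducible. -/
theorem IsPureState.isIrreducible {f : A →ₚ[ℂ] ℂ} (hf : IsPureState f) :
    IsIrreducible f.gnsNonUnitalStarAlgHom := by
  obtain ⟨ξ, -, hcyc, hfa⟩ := hf.1.exists_cyclic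
  refine hf.isIrreducible_of_cyclic (ξ := ξ) ?_ hfa
  simp_rw [hcyc]
  exact denseRange_gnsMk f

end GNS

/-! ### Inner automorphisms. -/

section Conjugation

variable {A : Type*} [NonUnitalCStarAlgebra A]

theorem unitaryGroup_star_mul_self (u : unitaryGroup A) :
    star (u : Unitization ℂ A) * (u : Unitization ℂ A) = 1 :=
  (Unitary.mem_iff.mp (u : unitary (Unitization ℂ A)).2).1

theorem unitaryGroup_mul_star_self (u : unitaryGroup A) :
    (u : Unitization ℂ A) * star (u : Unitization ℂ A) = 1 :=
  (Unitary.mem_iff.mp (u : unitary (Unitization ℂ A)).2).2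

theorem coe_mul_unitaryGroup (u v : unitaryGroup A) :
    ((u * v : unitaryGroup A) : Unitization ℂ A) = (u : Unitization ℂ A) * v := rfl

@[simp]
theorem Ad_one (a : A) : Ad (1 : unitaryGroup A) a = a := by
  refine Unitization.inr_injective (R := ℂ) ?_
  rw [inr_Ad]
  simp

theorem Ad_mul (u v : unitaryGroup A) (a : A) : Ad (u * v) a = Ad u (Ad v a) := by
  refine Unitization.inr_injective (R := ℂ) ?_
  rw [inr_Ad, inr_Ad, inr_Ad, coe_mul_unitaryGroup, star_mul]
  noncomm_ring

@[simp]
theorem Ad_inv_Ad (u : unitaryGroup A) (a : A) : Ad u⁻¹ (Ad u a) = a := by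
  rw [← Ad_mul, inv_mul_cancel, Ad_one]

@[simp]
theorem Ad_Ad_inv (u : unitaryGroup A) (a : A) : Ad u (Ad u⁻¹ a) = a := by
  rw [← Ad_mul, mul_inv_cancel, Ad_one]

/-- `Ad u` as an automorphism. -/
noncomputable def AdEquiv (u : unitaryGroup A) : A ≃⋆ₐ[ℂ] A where
  toFun := Ad u
  invFun := Ad u⁻¹
  left_inv := Ad_inv_Ad u
  right_inv := Ad_Ad_inv u
  map_add' a b := by
    refine Unitization.inr_injective (R := ℂ) ?_
    rw [Unitization.inr_add, inr_Ad, inr_Ad, inr_Ad, Unitization.inr_add, mul_add, add_mul]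
  map_mul' a b := by
    refine Unitization.inr_injective (R := ℂ) ?_
    rw [Unitization.inr_mul, inr_Ad, inr_Ad, inr_Ad, Unitization.inr_mul]
    calc _ = (u : Unitization ℂ A) * a * 1 * (b * star (u : Unitization ℂ A)) := by noncomm_ring
      _ = _ := by rw [← unitaryGroup_star_mul_self u]; noncomm_ring
  map_star' a := by
    refine Unitization.inr_injective (R := ℂ) ?_
    rw [Unitization.inr_star, inr_Ad, inr_Ad, Unitization.inr_star, star_mul, star_mul, star_star,
      mul_assoc]
  map_smul' c a := by
    refine Unitization.inr_injective (R := ℂ) ?_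
    rw [Unitization.inr_smul, inr_Ad, inr_Ad, Unitization.inr_smul, mul_smul_comm, smul_mul_assoc]

@[simp]
theorem AdEquiv_apply (u : unitaryGroup A) (a : A) : AdEquiv u a = Ad u a := rfl

theorem norm_Ad (u : unitaryGroup A) (a : A) : ‖Ad u a‖ = ‖a‖ :=
  NonUnitalStarAlgHom.norm_map (AdEquiv u) (AdEquiv u).injective a

theorem Ad_sub (u : unitaryGroup A) (a b : A) : Ad u (a - b) = Ad u a - Ad u b :=
  map_sub (AdEquiv u) a b

/-- Right multiplication by `u*` as a linear equivalence of `A`. -/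
noncomputable def rightMulStar (u : unitaryGroup A) : A ≃ₗ[ℂ] A where
  toFun a := ((a : Unitization ℂ A) * star (u : Unitization ℂ A)).snd
  invFun a := ((a : Unitization ℂ A) * (u : Unitization ℂ A)).snd
  map_add' a b := by rw [Unitization.inr_add, add_mul, Unitization.snd_add]
  map_smul' c a := by
    rw [Unitization.inr_smul, smul_mul_assoc, Unitization.snd_smul, RingHom.id_apply]
  left_inv a := by
    have h : ∀ z : Unitization ℂ A, (((a : Unitization ℂ A) * z).snd : Unitization ℂ A) = a * z :=
      fun z => Unitization.ext (by simp) rfl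
    change (((_ : A) : Unitization ℂ A) * (u : Unitization ℂ A)).snd = a
    rw [h, mul_assoc, unitaryGroup_star_mul_self, mul_one, Unitization.snd_inr]
  right_inv a := by
    have h : ∀ z : Unitization ℂ A, (((a : Unitization ℂ A) * z).snd : Unitization ℂ A) = a * z :=
      fun z => Unitization.ext (by simp) rfl
    change (((_ : A) : Unitization ℂ A) * star (u : Unitization ℂ A)).snd = a
    rw [h, mul_assoc, unitaryGroup_mul_star_self, mul_one, Unitization.snd_inr]

theorem inr_rightMulStar (u : unitaryGroup A) (a : A) :
    (rightMulStar u a : Unitization ℂ A) = a * star (u : Unitization ℂ A) :=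
  Unitization.ext (by simp) rfl

theorem rightMulStar_mul (u : unitaryGroup A) (a b : A) :
    rightMulStar u (a * b) = a * rightMulStar u b := by
  refine Unitization.inr_injective (R := ℂ) ?_
  rw [inr_rightMulStar, Unitization.inr_mul, Unitization.inr_mul, inr_rightMulStar, mul_assoc]

theorem star_rightMulStar_mul (u : unitaryGroup A) (a : A) :
    star (rightMulStar u a) * rightMulStar u a = Ad u (star a * a) := by
  refine Unitization.inr_injective (R := ℂ) ?_
  rw [Unitization.inr_mul, Unitization.inr_star, inr_rightMulStar, inr_Ad, Unitization.inr_mul,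
    Unitization.inr_star, star_mul, star_star]
  noncomm_ring

end Conjugation

/-! ### Unitary equivalence of representations. -/

section UnitaryEquivalence

variable {A : Type*} [NonUnitalCStarAlgebra A]
  {H : Type*} [NormedAddCommGroup H] [InnerProductSpace ℂ H] [CompleteSpace H]
  {K : Type*} [NormedAddCommGroup K] [InnerProductSpace ℂ K] [CompleteSpace K]

/-- Unitary equivalence of representations. -/
def UnitarilyEquivalent (π : A →⋆ₙₐ[ℂ] (H →L[ℂ] H)) (ρ : A →⋆ₙₐ[ℂ] (K →L[ℂ] K)) : Prop :=
  ∃ W : H ≃ₗᵢ[ℂ] K, ∀ a x, W (π a x) = ρ a (W x)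

variable {π : A →⋆ₙₐ[ℂ] (H →L[ℂ] H)} {ρ : A →⋆ₙₐ[ℂ] (K →L[ℂ] K)}

theorem UnitarilyEquivalent.symm (h : UnitarilyEquivalent π ρ) : UnitarilyEquivalent ρ π := by
  obtain ⟨W, hW⟩ := h
  refine ⟨W.symm, fun a x => ?_⟩
  apply W.injective
  rw [hW, W.apply_symm_apply, W.apply_symm_apply]

theorem UnitarilyEquivalent.meetsCompactsTrivially (h : UnitarilyEquivalent π ρ)
    (hπ : MeetsCompactsTrivially π) : MeetsCompactsTrivially ρ := by
  obtain ⟨W, hW⟩ := h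
  intro a ha
  have h1 : π a = (W.symm.toContinuousLinearEquiv : K →L[ℂ] H) ∘L ρ a ∘L
      (W.toContinuousLinearEquiv : H →L[ℂ] K) := by
    ext x
    change π a x = W.symm (ρ a (W x))
    rw [← hW, W.symm_apply_apply]
  have h2 : π a = 0 := hπ a (by
    rw [h1]
    exact (ha.comp_clm (W.toContinuousLinearEquiv : H →L[ℂ] K)).clm_comp
      (W.symm.toContinuousLinearEquiv : K →L[ℂ] H))
  ext x
  have := hW a (W.symm x)
  rw [h2, W.apply_symm_apply] at this
  simpa using this.symm

theorem UnitarilyEquivalent.apply_eq_zero_iff (h : UnitarilyEquivalent π ρ) (a : A) :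
    π a = 0 ↔ ρ a = 0 := by
  obtain ⟨W, hW⟩ := h
  constructor <;> intro h0
  · ext x
    have := hW a (W.symm x)
    rw [h0, W.apply_symm_apply] at this
    simpa using this.symm
  · ext x
    have := hW a x
    rw [h0] at this
    simpa using this

theorem conj_mem_bicommutant (W : H ≃ₗᵢ[ℂ] K) (hW : ∀ a, W.conjStarAlgEquiv (π a) = ρ a)
    {T : H →L[ℂ] H} (hT : T ∈ bicommutant π) : W.conjStarAlgEquiv T ∈ bicommutant ρ := by
  set C := W.conjStarAlgEquiv
  rw [bicommutant, StarSubalgebra.mem_centralizer_iff] at hT ⊢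
  intro g hg
  have hg' : C.symm g ∈ StarSubalgebra.centralizer ℂ (Set.range π) := by
    rw [StarSubalgebra.mem_centralizer_iff]
    rintro _ ⟨a, rfl⟩
    have h1 := (StarSubalgebra.mem_centralizer_iff ℂ).mp hg (ρ a) ⟨a, rfl⟩
    rw [← hW, ← map_star] at h1
    constructor
    · apply C.injective
      change C (_ * _) = C (_ * _)
      rw [map_mul, map_mul, C.apply_symm_apply]
      exact h1.1
    · apply C.injective
      change C (_ * _) = C (_ * _)
      rw [map_mul, map_mul, C.apply_symm_apply]
      exact h1.2
  have h2 := hT _ hg'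
  constructor
  · have := congrArg C h2.1
    rwa [map_mul, map_mul, C.apply_symm_apply] at this
  · have := congrArg C h2.2
    rwa [map_mul, map_mul, map_star, C.apply_symm_apply] at this

/-- Property A is only applied within one unitary orbit of states, so this supplies its
quasi-equivalence hypothesis. -/
theorem UnitarilyEquivalent.quasiEquivalent (h : UnitarilyEquivalent π ρ) :
    QuasiEquivalent π ρ := by
  obtain ⟨W, hW⟩ := h
  have hC : ∀ a, W.conjStarAlgEquiv (π a) = ρ a := by
    intro a
    ext x
    rw [LinearIsometryEquiv.conjStarAlgEquiv_apply_apply, hW, W.apply_symm_apply]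
  have hC' : ∀ a, W.symm.conjStarAlgEquiv (ρ a) = π a := by
    intro a
    rw [← hC, ← LinearIsometryEquiv.symm_conjStarAlgEquiv, StarAlgEquiv.symm_apply_apply]
  refine ⟨{ toFun := fun T => ⟨W.conjStarAlgEquiv T, conj_mem_bicommutant W hC T.2⟩
            invFun := fun T => ⟨W.symm.conjStarAlgEquiv T, conj_mem_bicommutant W.symm hC' T.2⟩
            left_inv := fun T => Subtype.ext (W.conjStarAlgEquiv.symm_apply_apply _)
            right_inv := fun T => Subtype.ext (W.conjStarAlgEquiv.apply_symm_apply _)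
            map_add' := fun S T => Subtype.ext (map_add W.conjStarAlgEquiv _ _)
            map_mul' := fun S T => Subtype.ext (map_mul W.conjStarAlgEquiv _ _)
            map_star' := fun T => Subtype.ext (map_star W.conjStarAlgEquiv _)
            map_smul' := fun c T => Subtype.ext (map_smul W.conjStarAlgEquiv _ _) },
    fun a => Subtype.ext (hC a)⟩

end UnitaryEquivalence

/-! ### Unitary conjugates of pure states. -/

section StateConjugation

variable {A : Type*} [NonUnitalCStarAlgebra A] [PartialOrder A] [StarOrderedRing A]

/-- The positive functional `f ∘ Ad u`. -/
noncomputable def conjState (f : A →ₚ[ℂ] ℂ) (u : unitaryGroup A) : A →ₚ[ℂ] ℂ :=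
  PositiveLinearMap.mk₀ (f.toLinearMap ∘ₗ (AdEquiv u : A →ₗ[ℂ] A)) fun a ha => by
    obtain ⟨b, rfl⟩ := CStarAlgebra.nonneg_iff_eq_star_mul_self.mp ha
    change 0 ≤ f (AdEquiv u (star b * b))
    rw [map_mul, map_star]
    exact f.map_nonneg (star_mul_self_nonneg _)

@[simp]
theorem conjState_apply (f : A →ₚ[ℂ] ℂ) (u : unitaryGroup A) (a : A) :
    conjState f u a = f (Ad u a) := rfl

theorem conjState_mul (f : A →ₚ[ℂ] ℂ) (u v : unitaryGroup A) :
    conjState f (u * v) = conjState (conjState f u) v := by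
  ext a
  simp [Ad_mul]

theorem conjState_one (f : A →ₚ[ℂ] ℂ) : conjState f 1 = f := by
  ext a
  simp

theorem norm_conjState_le (f : A →ₚ[ℂ] ℂ) (u : unitaryGroup A) :
    ‖(⟨(conjState f u).toLinearMap, map_continuous (conjState f u)⟩ : A →L[ℂ] ℂ)‖ ≤
      ‖(⟨f.toLinearMap, map_continuous f⟩ : A →L[ℂ] ℂ)‖ := by
  refine ContinuousLinearMap.opNorm_le_bound _ (norm_nonneg _) fun a => ?_
  rw [← norm_Ad u a]
  exact ContinuousLinearMap.le_opNorm (⟨f.toLinearMap, map_continuous f⟩ : A →L[ℂ] ℂ) (Ad u a)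

theorem Ad_nonneg (u : unitaryGroup A) {a : A} (ha : 0 ≤ a) : 0 ≤ Ad u a := by
  obtain ⟨b, rfl⟩ := CStarAlgebra.nonneg_iff_eq_star_mul_self.mp ha
  rw [← AdEquiv_apply, map_mul, map_star]
  exact star_mul_self_nonneg _

theorem IsPureState.conjState {f : A →ₚ[ℂ] ℂ} (hf : IsPureState f) (u : unitaryGroup A) :
    IsPureState (conjState f u) := by
  refine ⟨le_antisymm ?_ ?_, fun ψ hψ => ?_⟩
  · exact (norm_conjState_le f u).trans_eq hf.1
  · have := norm_conjState_le (CStarPure.conjState f u) u⁻¹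
    rw [← conjState_mul, mul_inv_cancel, conjState_one] at this
    exact (Eq.symm hf.1).trans_le this
  · obtain ⟨t, h0, h1, ht⟩ := hf.2 (CStarPure.conjState ψ u⁻¹) fun a ha => by
      have := hψ (Ad u⁻¹ a) (Ad_nonneg _ ha)
      simpa using this
    refine ⟨t, h0, h1, fun a => ?_⟩
    simpa using ht (Ad u a)

/-- The map `a ↦ a u*` commutes with left multiplication and is isometric for the two GNS seminorms,
because `(a u*)* (a u*) = Ad u (a* a)`. -/
theorem unitarilyEquivalent_conjState (f : A →ₚ[ℂ] ℂ) (u : unitaryGroup A) :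
    UnitarilyEquivalent (conjState f u).gnsNonUnitalStarAlgHom f.gnsNonUnitalStarAlgHom := by
  have hnorm : ∀ a, ‖gnsMk f (rightMulStar u a)‖ = ‖gnsMk (conjState f u) a‖ := by
    intro a
    rw [← sq_eq_sq₀ (norm_nonneg _) (norm_nonneg _), norm_gnsMk_sq, norm_gnsMk_sq,
      star_rightMulStar_mul, conjState_apply]
  let W := (rightMulStar u).extendOfIsometry (gnsMk (conjState f u)) (gnsMk f)
    (denseRange_gnsMk _) (denseRange_gnsMk _) hnorm
  have hW : ∀ a, W (gnsMk (conjState f u) a) = gnsMk f (rightMulStar u a) := fun a =>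
    LinearEquiv.extendOfIsometry_eq _ _ _ _ _ _ _
  refine ⟨W, fun a x => ?_⟩
  induction x using (denseRange_gnsMk (conjState f u)).induction_on with
  | hp => exact isClosed_eq (by fun_prop) (by fun_prop)
  | ih b => rw [gns_apply_gnsMk, hW, hW, gns_apply_gnsMk, rightMulStar_mul]

end StateConjugation

/-! ### Exponential paths of unitaries. -/

section ExponentialPath

variable {A : Type*} [NonUnitalCStarAlgebra A]

/-- The one-parameter group `t ↦ exp (i t h)` in `U(A)`. -/
theorem exists_continuous_exp {h : A} (hh : IsSelfAdjoint h) :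
    ∃ u : ℝ → unitaryGroup A, Continuous u ∧ u 0 = 1 ∧
      (u 1 : Unitization ℂ A) = NormedSpace.exp (Complex.I • (h : Unitization ℂ A)) := by
  have hsa : ∀ t : ℝ, IsSelfAdjoint ((t : ℂ) • (h : Unitization ℂ A)) := by
    intro t
    change star _ = _
    rw [star_smul, ← Unitization.inr_star, hh.star_eq]
    simp
  let k : ℝ → selfAdjoint (Unitization ℂ A) := fun t => ⟨(t : ℂ) • (h : Unitization ℂ A), hsa t⟩
  have hk : Continuous k := by
    refine Continuous.subtype_mk ?_ _
    exact (Complex.continuous_ofReal).smul continuous_const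
  -- Scalar part `1` gives membership in `unitaryGroup A` whether or not `A` has an identity.
  have hfst : ∀ x : Unitization ℂ A, x.fst = 0 → (NormedSpace.exp x).fst = 1 := by
    intro x hx
    have hc : Continuous (Unitization.fstHom ℂ A) := by
      exact Unitization.continuous_fst
    let _ : NormedAlgebra ℚ (Unitization ℂ A) := .restrictScalars ℚ ℂ _
    have := NormedSpace.map_exp (Unitization.fstHom ℂ A) hc x
    change (NormedSpace.exp x).fst = NormedSpace.exp x.fst at this
    rw [this, hx, NormedSpace.exp_zero]
  let u : ℝ → unitaryGroup A := fun t => ⟨selfAdjoint.expUnitary (k t), fun _ => by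
    rw [selfAdjoint.expUnitary_coe]
    exact hfst _ (by simp [k])⟩
  refine ⟨u, ?_, ?_, ?_⟩
  · exact (selfAdjoint.continuous_expUnitary.comp hk).subtype_mk _
  · apply Subtype.ext
    have : k 0 = 0 := Subtype.ext (by simp [k])
    change selfAdjoint.expUnitary (k 0) = 1
    rw [this, selfAdjoint.expUnitary_zero]
  · change (selfAdjoint.expUnitary (k 1) : Unitization ℂ A) = _
    rw [selfAdjoint.expUnitary_coe]
    simp [k]

variable {H : Type*} [NormedAddCommGroup H] [InnerProductSpace ℂ H] [CompleteSpace H]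

/-- Any two vector states of an irreducible representation are conjugate by a unitary in the
identity component. -/
theorem IsIrreducible.exists_path_inner_eq {π : A →⋆ₙₐ[ℂ] (H →L[ℂ] H)} (hπ : IsIrreducible π)
    {ξ η : H} (hξ : ‖ξ‖ = 1) (hη : ‖η‖ = 1) :
    ∃ u : ℝ → unitaryGroup A, Continuous u ∧ u 0 = 1 ∧
      ∀ a, inner ℂ η (π a η) = inner ℂ ξ (π (Ad (u 1) a) ξ) := by
  -- The unitary carries `η` to a multiple of `ξ`; the phase `c` disappears in the vector state.
  obtain ⟨h, c, hh, hc, hexp⟩ := hπ.exists_exp_apply_eq_smul hη hξ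
  obtain ⟨u, hu, hu0, hu1⟩ := exists_continuous_exp hh
  refine ⟨u, hu, hu0, fun a => ?_⟩
  let σ : Unitization ℂ A →⋆ₐ[ℂ] (H →L[ℂ] H) := Unitization.starLift π
  have hσ : ∀ b : A, σ b = π b := fun b => by
    change algebraMap ℂ _ (b : Unitization ℂ A).fst + π (b : Unitization ℂ A).snd = π b
    simp
  have hσc : Continuous σ := continuous_representation (σ : Unitization ℂ A →⋆ₙₐ[ℂ] (H →L[ℂ] H))
  have hσu : σ (u 1) = NormedSpace.exp (Complex.I • π h) := by
    let _ : NormedAlgebra ℚ (Unitization ℂ A) := .restrictScalars ℚ ℂ _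
    let _ : NormedAlgebra ℚ (H →L[ℂ] H) := .restrictScalars ℚ ℂ _
    rw [hu1, NormedSpace.map_exp σ hσc, map_smul, hσ]
  have h1 : σ (u 1) η = c • ξ := by rw [hσu, hexp]
  have h2 : star (σ (u 1)) (σ (u 1) η) = η := by
    rw [← map_star, ← mul_apply_eq_comp, ← map_mul, unitaryGroup_star_mul_self, map_one]
    rfl
  have h3 : ∀ a, inner ℂ (c • ξ) (π (Ad (u 1) a) (c • ξ)) = inner ℂ ξ (π (Ad (u 1) a) ξ) := by
    intro a
    rw [map_smul, inner_smul_left, inner_smul_right, ← mul_assoc, Complex.conj_mul', hc]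
    simp
  rw [← h3, ← h1, ← hσ (Ad _ _), inr_Ad, map_mul, map_mul, map_star, hσ, mul_apply_eq_comp,
    mul_apply_eq_comp, h2, ← ContinuousLinearMap.adjoint_inner_left (σ (u 1)),
    ← ContinuousLinearMap.star_eq_adjoint, h2]

end ExponentialPath

/-! ### Compactness of convex hulls. -/

section ConvexHull

variable {E : Type*} [AddCommGroup E] [Module ℝ E] [TopologicalSpace E] [IsTopologicalAddGroup E]
  [ContinuousSMul ℝ E]

theorem isCompact_convexJoin {s t : Set E} (hs : IsCompact s) (ht : IsCompact t) :
    IsCompact (convexJoin ℝ s t) := by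
  have h : convexJoin ℝ s t =
      (fun p : ℝ × E × E => (1 - p.1) • p.2.1 + p.1 • p.2.2) '' (Set.Icc 0 1 ×ˢ s ×ˢ t) := by
    ext x
    simp only [mem_convexJoin, segment_eq_image, Set.mem_image, Set.mem_prod, Prod.exists]
    constructor
    · rintro ⟨a, ha, b, hb, θ, hθ, rfl⟩
      exact ⟨θ, a, b, ⟨hθ, ha, hb⟩, rfl⟩
    · rintro ⟨θ, a, b, ⟨hθ, ha, hb⟩, rfl⟩
      exact ⟨a, ha, b, hb, θ, hθ, rfl⟩
  rw [h]
  exact (isCompact_Icc.prod (hs.prod ht)).image (by fun_prop)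

theorem isCompact_convexHull_union {s t : Set E} (hs : IsCompact s) (hsc : Convex ℝ s)
    (ht : IsCompact (convexHull ℝ t)) : IsCompact (convexHull ℝ (s ∪ t)) := by
  rcases s.eq_empty_or_nonempty with rfl | hs0
  · rwa [Set.empty_union]
  rcases t.eq_empty_or_nonempty with rfl | ht0
  · rwa [Set.union_empty, hsc.convexHull_eq]
  rw [← convexHull_convexHull_union_right, hsc.convexHull_union (convex_convexHull ℝ t) hs0
    ht0.convexHull]
  exact isCompact_convexJoin hs ht

/-- Convexity of the pieces matters: the hull of a general compact set need not be closed. Here no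
closure is taken, so extreme points of the hull lie in the pieces. -/
theorem isCompact_convexHull_biUnion {ι : Type*} (I : Finset ι) (C : ι → Set E)
    (hC : ∀ i, IsCompact (C i)) (hCc : ∀ i, Convex ℝ (C i)) :
    IsCompact (convexHull ℝ (⋃ i ∈ I, C i)) := by
  classical
  induction I using Finset.induction_on with
  | empty => simp
  | insert i I _ ih =>
    rw [Finset.set_biUnion_insert]
    exact isCompact_convexHull_union (hC i) (hCc i) ih

end ConvexHull

/-! ### The weak* compact convex set of quasi-states. -/

section QuasiStates

variable {A : Type*} [NonUnitalCStarAlgebra A]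

theorem isScalarTower_weakDual : IsScalarTower ℝ ℂ (WeakDual ℂ A) :=
  ⟨fun r c f => DFunLike.ext _ _ fun a => by
    change (r • c) • f a = r • (c • f a)
    rw [smul_assoc]⟩

theorem locallyConvexSpace_weakDual : LocallyConvexSpace ℝ (WeakDual ℂ A) :=
  inferInstanceAs (LocallyConvexSpace ℝ (WeakBilin (topDualPairing ℂ A)))

theorem exists_eq_eval_weakDual (F : StrongDual ℂ (WeakDual ℂ A)) :
    ∃ a : A, ∀ φ : WeakDual ℂ A, F φ = φ a := by
  obtain ⟨a, ha⟩ := LinearMap.dualEmbedding_surjective (topDualPairing ℂ A) F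
  exact ⟨a, fun φ => by rw [← ha]; rfl⟩

variable [PartialOrder A]

variable (A) in
/-- The positive functionals of norm at most one. -/
def quasiStates : Set (WeakDual ℂ A) :=
  {φ | (∀ a, 0 ≤ a → 0 ≤ φ a) ∧ ∀ a, ‖φ a‖ ≤ ‖a‖}

/-- The condition is norm at most one because without a unit the states themselves need not be weak*
closed. -/
theorem isCompact_quasiStates : IsCompact (quasiStates A) := by
  have hclosed : IsClosed (quasiStates A) := by
    simp only [quasiStates, Set.ofPred_and, Set.ofPred_forall]
    refine IsClosed.inter ?_ ?_
    · refine isClosed_iInter fun a => isClosed_iInter fun _ => ?_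
      exact isClosed_le continuous_const (WeakDual.eval_continuous a)
    · refine isClosed_iInter fun a => ?_
      exact isClosed_le (WeakDual.eval_continuous a).norm continuous_const
  refine (WeakDual.isCompact_closedBall (𝕜 := ℂ) (E := A) 0 1).of_isClosed_subset hclosed ?_
  intro φ hφ
  rw [Set.mem_preimage, mem_closedBall_zero_iff]
  refine ContinuousLinearMap.opNorm_le_bound _ zero_le_one fun a => ?_
  rw [one_mul]
  exact hφ.2 a

theorem convex_quasiStates : Convex ℝ (quasiStates A) := by
  intro φ hφ ψ hψ s t hs ht hst
  refine ⟨fun a ha => ?_, fun a => ?_⟩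
  · change 0 ≤ s • φ a + t • ψ a
    exact add_nonneg (smul_nonneg hs (hφ.1 a ha)) (smul_nonneg ht (hψ.1 a ha))
  · change ‖s • φ a + t • ψ a‖ ≤ _
    refine (norm_add_le _ _).trans ?_
    rw [norm_smul, norm_smul, Real.norm_of_nonneg hs, Real.norm_of_nonneg ht]
    calc _ ≤ s * ‖a‖ + t * ‖a‖ := by
          gcongr
          · exact hφ.2 a
          · exact hψ.2 a
      _ = ‖a‖ := by rw [← add_mul, hst, one_mul]

variable [StarOrderedRing A]

/-- A positive functional as an element of the weak dual. -/
noncomputable def toWeak (f : A →ₚ[ℂ] ℂ) : WeakDual ℂ A :=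
  StrongDual.toWeakDual (⟨f.toLinearMap, map_continuous f⟩ : A →L[ℂ] ℂ)

@[simp]
theorem toWeak_apply (f : A →ₚ[ℂ] ℂ) (a : A) : toWeak f a = f a := rfl

theorem IsState.toWeak_mem {f : A →ₚ[ℂ] ℂ} (hf : IsState f) : toWeak f ∈ quasiStates A :=
  ⟨fun _ ha => f.map_nonneg ha, hf.norm_apply_le⟩

theorem IsState.le_of_forall_mul_le {f : A →ₚ[ℂ] ℂ} (hf : IsState f) {c s : ℝ} (hs : 0 ≤ s)
    (h : ∀ a, c * ‖f a‖ ≤ s * ‖a‖) : c ≤ s := by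
  rcases le_or_gt c 0 with hc | hc
  · exact hc.trans hs
  · have h1 : ‖(⟨f.toLinearMap, map_continuous f⟩ : A →L[ℂ] ℂ)‖ ≤ s / c := by
      refine ContinuousLinearMap.opNorm_le_bound _ (by positivity) fun a => ?_
      rw [div_mul_eq_mul_div, le_div_iff₀ hc, mul_comm]
      exact h a
    rw [show _ = (1 : ℝ) from hf, one_le_div hc] at h1
    exact h1

/-- If `f = sφ + tψ`, purity gives `sφ = c f` and `tψ = (1 - c) f`. Comparing norms, `c ≤ s` and `1
- c ≤ t`; as `s + t = 1`, both are equalities, so `φ = f`. -/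
theorem IsPureState.mem_extremePoints {f : A →ₚ[ℂ] ℂ} (hf : IsPureState f) :
    toWeak f ∈ Set.extremePoints ℝ (quasiStates A) := by
  rw [mem_extremePoints_iff_left]
  refine ⟨hf.1.toWeak_mem, ?_⟩
  rintro φ hφ ψ hψ ⟨s, t, hs, ht, hst, hf'⟩
  have hfa : ∀ a, (s : ℂ) * φ a + (t : ℂ) * ψ a = f a := by
    intro a
    have := DFunLike.congr_fun hf' a
    change s • φ a + t • ψ a = f a at this
    simpa using this
  let χ : A →ₚ[ℂ] ℂ := PositiveLinearMap.mk₀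
    ((s : ℂ) • ((WeakDual.toStrongDual φ : A →L[ℂ] ℂ) : A →ₗ[ℂ] ℂ)) fun a ha => by
      change 0 ≤ (s : ℂ) * φ a
      exact mul_nonneg (by exact_mod_cast hs.le) (hφ.1 a ha)
  have hχ : ∀ a, χ a = (s : ℂ) * φ a := fun a => rfl
  obtain ⟨c, hc0, hc1, hc⟩ := hf.2 χ fun a ha => by
    rw [hχ, ← hfa a]
    exact le_add_of_nonneg_right (mul_nonneg (by exact_mod_cast ht.le) (hψ.1 a ha))
  have h1 : c ≤ s := hf.1.le_of_forall_mul_le hs.le fun a => by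
    have := congrArg norm ((hc a).symm.trans (hχ a))
    rw [norm_mul, norm_mul, Complex.norm_of_nonneg hc0, Complex.norm_of_nonneg hs.le] at this
    rw [this]
    exact mul_le_mul_of_nonneg_left (hφ.2 a) hs.le
  have h2 : 1 - c ≤ t := hf.1.le_of_forall_mul_le ht.le fun a => by
    have h3 : ((1 - c : ℝ) : ℂ) * f a = (t : ℂ) * ψ a := by
      have := (hc a).symm.trans (hχ a)
      push_cast
      linear_combination hfa a - this - 2 * hfa a + 2 * hfa a - 2 * (hfa a) + 0 * this
    have := congrArg norm h3
    rw [norm_mul, norm_mul, Complex.norm_of_nonneg (by linarith), Complex.norm_of_nonneg ht.le]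
      at this
    rw [this]
    exact mul_le_mul_of_nonneg_left (hψ.2 a) ht.le
  have hcs : c = s := by linarith
  refine DFunLike.ext _ _ fun a => ?_
  have h3 := (hc a).symm.trans (hχ a)
  rw [hcs] at h3
  exact (mul_left_cancel₀ (by exact_mod_cast hs.ne') h3).symm

end QuasiStates

section

variable {A : Type*} [NonUnitalCStarAlgebra A]
  {H : Type*} [NormedAddCommGroup H] [InnerProductSpace ℂ H] [CompleteSpace H]

theorem norm_inner_representation_le (π : A →⋆ₙₐ[ℂ] (H →L[ℂ] H)) {η : H} (hη : ‖η‖ = 1) (a : A) :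
    ‖inner ℂ η (π a η)‖ ≤ ‖a‖ := by
  refine (norm_inner_le_norm _ _).trans ?_
  rw [hη, one_mul]
  have := ContinuousLinearMap.le_of_opNorm_le _ (norm_representation_le π a) η
  rwa [hη, mul_one] at this

end

/-! ### Weak* approximation by vector states. -/

section VectorStates

variable {A : Type*} [NonUnitalCStarAlgebra A] [PartialOrder A] [StarOrderedRing A]
  {H : Type*} [NormedAddCommGroup H] [InnerProductSpace ℂ H] [CompleteSpace H]
  {π : A →⋆ₙₐ[ℂ] (H →L[ℂ] H)} {f : A →ₚ[ℂ] ℂ}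

/-- If `ker π ⊆ ker π_f` then an upper bound for the numerical range of `π(a)` bounds `f(a)`. -/
theorem IsState.re_apply_le_of_inner_le (hf : IsState f)
    (hker : ∀ a, π a = 0 → f.gnsNonUnitalStarAlgHom a = 0) {a : A} (ha : IsSelfAdjoint a) {u : ℝ}
    (hu : 0 ≤ u) (h : ∀ η : H, ‖η‖ = 1 → (inner ℂ η (π a η)).re ≤ u) : (f a).re ≤ u := by
  have hsa : IsSelfAdjoint (π a) := ha.map π
  have hle : π a ≤ algebraMap ℝ (H →L[ℂ] H) u := by
    rw [← sub_nonneg, ContinuousLinearMap.nonneg_iff_isPositive]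
    have hsa' : IsSelfAdjoint (algebraMap ℝ (H →L[ℂ] H) u - π a) :=
      (IsSelfAdjoint.algebraMap _ (IsSelfAdjoint.all u)).sub hsa
    rw [ContinuousLinearMap.isPositive_def']
    refine ⟨hsa', fun x => ?_⟩
    rw [ContinuousLinearMap.reApplyInnerSelf_apply]
    by_cases hx : x = 0
    · simp [hx]
    have h1 := h ((‖x‖ : ℂ)⁻¹ • x) (by simp [norm_smul, hx])
    rw [map_smul, inner_smul_left, inner_smul_right, ← mul_assoc, Complex.conj_mul', norm_inv,
      Complex.norm_real, norm_norm, ← Complex.ofReal_pow,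
      Complex.re_ofReal_mul, inv_pow, inv_mul_le_iff₀ (by positivity)] at h1
    have h2 : RCLike.re (inner ℂ ((algebraMap ℝ (H →L[ℂ] H) u - π a) x) x)
        = ‖x‖ ^ 2 * u - (inner ℂ x (π a x)).re := by
      rw [← inner_conj_symm, RCLike.conj_re, sub_apply, inner_sub_right, Algebra.algebraMap_eq_smul_one,
        smul_apply, one_apply_eq_self]
      have : inner ℂ x (u • x) = ((‖x‖ ^ 2 * u : ℝ) : ℂ) := by
        rw [← Complex.coe_smul, inner_smul_right, inner_self_eq_norm_sq_to_K]
        push_cast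
        simp [mul_comm]
      rw [this, map_sub, RCLike.re_to_complex, RCLike.re_to_complex, Complex.ofReal_re]
    rw [h2]
    linarith
  have hspec : ∀ t ∈ spectrum ℝ (π a), t ≤ u := (le_algebraMap_iff_spectrum_le hsa).mp hle
  -- Split `a` into the excess above `u`, killed by `π` and hence by `f`, and a truncation of norm
  -- at most `u`. Both functions vanish at `0` since `0 ≤ u`, as the nonunital calculus requires.
  let g₁ : ℝ → ℝ := fun t => max (t - u) 0
  let g₂ : ℝ → ℝ := fun t => max 0 (min t u)
  let b₁ := cfcₙ g₁ a
  let b₂ := cfcₙ g₂ a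
  have h01 : g₁ 0 = 0 := by simp [g₁, hu]
  have h02 : g₂ 0 = 0 := by simp [g₂, hu]
  have hc1 : Continuous g₁ := by fun_prop
  have hc2 : Continuous g₂ := by fun_prop
  have hb₁ : π b₁ = 0 := by
    rw [NonUnitalStarAlgHomClass.map_cfcₙ π g₁ a hc1.continuousOn h01 (continuous_representation π)
      ha hsa, ← cfcₙ_zero ℝ (π a)]
    refine cfcₙ_congr fun t ht => ?_
    rw [quasispectrum_eq_spectrum_union_zero] at ht
    rcases ht with ht | rfl
    · simpa [g₁] using hspec t ht
    · simpa [g₁] using hu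
  have hfb₁ : f b₁ = 0 := by
    obtain ⟨ξ, -, -, hξ⟩ := hf.exists_cyclic
    rw [hξ, hker b₁ hb₁]
    simp
  have hb₂ : ‖b₂‖ ≤ u := by
    refine norm_cfcₙ_le fun t _ => ?_
    rw [Real.norm_of_nonneg (le_max_left _ _)]
    exact max_le hu (min_le_right _ _)
  have hab : a ≤ b₁ + b₂ := by
    rw [← cfcₙ_add g₁ g₂ a hc1.continuousOn h01 hc2.continuousOn h02]
    conv_lhs => rw [← cfcₙ_id' ℝ a]
    refine cfcₙ_mono fun t _ => ?_
    change t ≤ max (t - u) 0 + max 0 (min t u)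
    rcases le_total t u with htu | htu
    · rw [min_eq_left htu]
      exact (le_max_right 0 t).trans (le_add_of_nonneg_left (le_max_right _ _))
    · rw [min_eq_right htu, max_eq_left (by linarith : (0 : ℝ) ≤ t - u), max_eq_right hu]
      linarith
  have h1 : f a ≤ f b₁ + f b₂ := by
    rw [← map_add]
    exact OrderHomClass.mono f hab
  rw [hfb₁, zero_add] at h1
  calc (f a).re ≤ (f b₂).re := (Complex.le_def.mp h1).1
    _ ≤ ‖f b₂‖ := Complex.re_le_norm _
    _ ≤ u := (hf.norm_apply_le _).trans hb₂

/-- The vector functional of `π` at `η`. -/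
noncomputable def vectorFunctional (π : A →⋆ₙₐ[ℂ] (H →L[ℂ] H)) (η : H) : A →ₚ[ℂ] ℂ :=
  PositiveLinearMap.mk₀
    { toFun := fun a => inner ℂ η (π a η)
      map_add' := fun a b => by simp
      map_smul' := fun c a => by simp } fun a ha => by
    obtain ⟨b, rfl⟩ := CStarAlgebra.nonneg_iff_eq_star_mul_self.mp ha
    change 0 ≤ inner ℂ η (π (star b * b) η)
    have := inner_map_star π (star b) η (π b η)
    rw [star_star] at this
    rw [map_mul, mul_apply_eq_comp, ← this, inner_self_eq_norm_sq_to_K,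
      ← RCLike.ofReal_pow]
    exact RCLike.ofReal_nonneg.mpr (sq_nonneg _)

@[simp]
theorem vectorFunctional_apply (η : H) (a : A) :
    vectorFunctional π η a = inner ℂ η (π a η) := rfl

theorem re_apply_realPart (g : A →ₚ[ℂ] ℂ) (b : A) : (g (realPart b : A)).re = (g b).re := by
  have h1 : g (star b) = star (g b) := map_star g b
  rw [realPart_apply_coe, ← Complex.coe_smul, map_smul, map_add, h1]
  simp
  ring

/-- A pure state `f` with `ker π ⊆ ker π_f` is a weak* limit of vector states of `π`. -/
theorem IsPureState.exists_vector_approx (hf : IsPureState f)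
    (hker : ∀ a, π a = 0 → f.gnsNonUnitalStarAlgHom a = 0) (G : Finset A) {δ : ℝ} (hδ : 0 < δ) :
    ∃ η : H, ‖η‖ = 1 ∧ ∀ x ∈ G, ‖inner ℂ η (π x η) - f x‖ < δ := by
  classical
  by_contra! hcon
  -- Being `δ`-far from `f` at some `x ∈ G` is not a convex condition. It is covered by half-spaces
  -- for `±1, ±i`: if all four real parts were below `δ / 2`, the modulus would be below `δ`.
  let C : A × ℂ → Set (WeakDual ℂ A) := fun p =>
    quasiStates A ∩ {φ | δ / 2 ≤ (p.2 * (φ p.1 - f p.1)).re}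
  have hCc : ∀ p, IsCompact (C p) := fun p => by
    refine isCompact_quasiStates.inter_right (isClosed_le continuous_const ?_)
    have := WeakDual.eval_continuous (𝕜 := ℂ) p.1
    exact Complex.continuous_re.comp (continuous_const.mul (this.sub continuous_const))
  have hCx : ∀ p, Convex ℝ (C p) := fun p => by
    refine convex_quasiStates.inter ?_
    intro φ hφ ψ hψ s t hs ht hst
    simp only [Set.mem_ofPred_eq] at hφ hψ ⊢
    change δ / 2 ≤ (p.2 * ((s • φ p.1 + t • ψ p.1) - f p.1)).re
    have h1 : p.2 * ((s • φ p.1 + t • ψ p.1) - f p.1) =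
        (s : ℂ) * (p.2 * (φ p.1 - f p.1)) + (t : ℂ) * (p.2 * (ψ p.1 - f p.1)) := by
      have : (s : ℂ) + t = 1 := by exact_mod_cast hst
      simp only [Complex.real_smul]
      linear_combination (p.2 * f p.1) * this
    rw [h1, Complex.add_re, Complex.re_ofReal_mul, Complex.re_ofReal_mul]
    calc δ / 2 = s * (δ / 2) + t * (δ / 2) := by rw [← add_mul, hst, one_mul]
      _ ≤ _ := by gcongr
  let I : Finset (A × ℂ) := G ×ˢ {1, -1, Complex.I, -Complex.I}
  -- Including `0` forces the separating bound `u` to be positive.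
  let X : Set (WeakDual ℂ A) := {0} ∪ ⋃ p ∈ I, C p
  have hXc : IsCompact (convexHull ℝ X) :=
    isCompact_convexHull_union isCompact_singleton (convex_singleton 0)
      (isCompact_convexHull_biUnion I C hCc hCx)
  have hXQ : convexHull ℝ X ⊆ quasiStates A := by
    refine convexHull_min ?_ convex_quasiStates
    rintro φ (rfl | hφ)
    · exact ⟨fun a _ => le_refl (0 : ℂ), fun a => (norm_zero (E := ℂ)).trans_le (norm_nonneg a)⟩
    · obtain ⟨p, -, hp⟩ := Set.mem_iUnion₂.mp hφ
      exact hp.1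
  -- As an extreme point of the quasi-states, `f` could lie in the hull only by lying in `X`; but it
  -- is nonzero and fails each half-space condition.
  have hfX : toWeak f ∉ convexHull ℝ X := by
    intro hmem
    have h1 := extremePoints_convexHull_subset
      (inter_extremePoints_subset_extremePoints_of_subset hXQ ⟨hmem, hf.mem_extremePoints⟩)
    rcases h1 with h1 | h1
    · have h2 := hf.1.le_of_forall_mul_le (c := 1) le_rfl fun a => by
        have : f a = 0 := by
          have := DFunLike.congr_fun (Set.mem_singleton_iff.mp h1) a
          exact this
        simp [this]
      linarith
    · obtain ⟨p, -, hp⟩ := Set.mem_iUnion₂.mp h1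
      have := hp.2
      simp only [Set.mem_ofPred_eq, toWeak_apply, sub_self, mul_zero, Complex.zero_re] at this
      linarith
  obtain ⟨F, u, hFu, huF⟩ := @RCLike.geometric_hahn_banach_closed_point ℂ (WeakDual ℂ A) _ _ _
    (convexHull ℝ X) (toWeak f) _ _ isScalarTower_weakDual _ _ locallyConvexSpace_weakDual
    (convex_convexHull ℝ X) hXc.isClosed hfX
  obtain ⟨b, hb⟩ := exists_eq_eval_weakDual F
  have hu : 0 < u := by
    have := hFu 0 (subset_convexHull ℝ X (Or.inl rfl))
    simpa using this
  have hvec : ∀ η : H, ‖η‖ = 1 → (inner ℂ η (π (realPart b : A) η)).re ≤ u := by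
    intro η hη
    rw [← vectorFunctional_apply, re_apply_realPart]
    have hmem : toWeak (vectorFunctional π η) ∈ X := by
      right
      obtain ⟨x, hx, hxδ⟩ := hcon η hη
      set z := inner ℂ η (π x η) - f x with hz
      have hQ : toWeak (vectorFunctional π η) ∈ quasiStates A :=
        ⟨fun _ ha => (vectorFunctional π η).map_nonneg ha, norm_inner_representation_le π hη⟩
      have hc : ∃ c ∈ ({1, -1, Complex.I, -Complex.I} : Finset ℂ), δ / 2 ≤ (c * z).re := by
        by_contra! hlt
        have e1 := hlt 1 (by simp)
        have e2 := hlt (-1) (by simp)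
        have e3 := hlt Complex.I (by simp)
        have e4 := hlt (-Complex.I) (by simp)
        simp at e1 e2 e3 e4
        have h1 : |z.re| < δ / 2 := abs_lt.mpr ⟨by linarith, e1⟩
        have h2 : |z.im| < δ / 2 := abs_lt.mpr ⟨by linarith, by linarith⟩
        have := Complex.norm_le_abs_re_add_abs_im z
        linarith
      obtain ⟨c, hcI, hcδ⟩ := hc
      exact Set.mem_iUnion₂.mpr ⟨(x, c), Finset.mem_product.mpr ⟨hx, hcI⟩, hQ, hcδ⟩
    have := hFu _ (subset_convexHull ℝ X hmem)
    rw [hb] at this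
    exact this.le
  have hfin := hf.1.re_apply_le_of_inner_le hker (realPart b).2 hu.le hvec
  rw [re_apply_realPart] at hfin
  rw [hb] at huF
  exact absurd huF (not_lt.mpr hfin)

end VectorStates

/-! ### Weak limits in Hilbert space. -/

section WeakLimits

variable {H : Type*} [NormedAddCommGroup H] [InnerProductSpace ℂ H] [CompleteSpace H]
  {ι : Type*}

/-- The unit ball of a Hilbert space is weakly compact, in terms of ultrafilters. -/
theorem exists_weak_limit (𝒰 : Ultrafilter ι) (η : ι → H) (hη : ∀ i, ‖η i‖ ≤ 1) :
    ∃ η₀ : H, ‖η₀‖ ≤ 1 ∧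
      ∀ ζ, Tendsto (fun i => inner ℂ (η i) ζ) 𝒰 (𝓝 (inner ℂ η₀ ζ)) := by
  let g : ι → WeakDual ℂ H := fun i => StrongDual.toWeakDual (InnerProductSpace.toDual ℂ H (η i))
  obtain ⟨L, hL, hlim⟩ := (WeakDual.isCompact_closedBall (𝕜 := ℂ) (E := H) 0 1).ultrafilter_le_nhds
    (𝒰.map g) (by
      rw [le_principal_iff, Ultrafilter.mem_coe, Ultrafilter.mem_map]
      refine Filter.univ_mem' fun i => ?_
      change (InnerProductSpace.toDual ℂ H (η i)) ∈ Metric.closedBall 0 1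
      rw [mem_closedBall_zero_iff, LinearIsometryEquiv.norm_map]
      exact hη i)
  refine ⟨(InnerProductSpace.toDual ℂ H).symm (WeakDual.toStrongDual L), ?_, fun ζ => ?_⟩
  · rw [LinearIsometryEquiv.norm_map]
    rwa [Set.mem_preimage, mem_closedBall_zero_iff] at hL
  · rw [InnerProductSpace.toDual_symm_apply]
    have h1 : Tendsto g 𝒰 (𝓝 L) := hlim
    exact ((WeakDual.eval_continuous ζ).tendsto L).comp h1

/-- A compact operator maps weakly convergent bounded ultrafilters to norm convergent ones. -/
theorem IsCompactOperator.tendsto_of_weak_limit {T : H →L[ℂ] H} (hT : IsCompactOperator T)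
    {𝒰 : Ultrafilter ι} {η : ι → H} (hη : ∀ i, ‖η i‖ ≤ 1) {η₀ : H}
    (hlim : ∀ ζ, Tendsto (fun i => inner ℂ (η i) ζ) 𝒰 (𝓝 (inner ℂ η₀ ζ))) :
    Tendsto (fun i => T (η i)) 𝒰 (𝓝 (T η₀)) := by
  have hK : IsCompact (closure (T '' Metric.closedBall 0 1)) :=
    hT.isCompact_closure_image_closedBall (𝕜₁ := ℂ) (f := (T : H →ₗ[ℂ] H)) 1
  obtain ⟨y, -, hy⟩ := hK.ultrafilter_le_nhds (𝒰.map fun i => T (η i)) (by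
    rw [le_principal_iff, Ultrafilter.mem_coe, Ultrafilter.mem_map]
    refine Filter.univ_mem' fun i => subset_closure ⟨η i, ?_, rfl⟩
    rw [mem_closedBall_zero_iff]
    exact hη i)
  have hy' : Tendsto (fun i => T (η i)) 𝒰 (𝓝 y) := hy
  have : y = T η₀ := by
    refine ext_inner_right ℂ fun ζ => ?_
    refine tendsto_nhds_unique (hy'.inner tendsto_const_nhds) ?_
    simp_rw [← ContinuousLinearMap.adjoint_inner_right]
    exact hlim _
  rwa [← this]

theorem IsCompactOperator.tendsto_inner_of_weak_limit {T : H →L[ℂ] H} (hT : IsCompactOperator T)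
    {𝒰 : Ultrafilter ι} {η : ι → H} (hη : ∀ i, ‖η i‖ ≤ 1) {η₀ : H}
    (hlim : ∀ ζ, Tendsto (fun i => inner ℂ (η i) ζ) 𝒰 (𝓝 (inner ℂ η₀ ζ))) :
    Tendsto (fun i => inner ℂ (η i) (T (η i))) 𝒰 (𝓝 (inner ℂ η₀ (T η₀))) := by
  have h1 := IsCompactOperator.tendsto_of_weak_limit hT hη hlim
  have h2 : Tendsto (fun i => inner ℂ (η i) (T (η i) - T η₀)) 𝒰 (𝓝 0) := by
    refine squeeze_zero_norm (fun i => ?_) (tendsto_iff_norm_sub_tendsto_zero.mp h1)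
    refine (norm_inner_le_norm _ _).trans ?_
    exact mul_le_of_le_one_left (norm_nonneg _) (hη i)
  have h3 := (hlim (T η₀)).add h2
  rw [add_zero] at h3
  refine h3.congr fun i => ?_
  rw [← inner_add_right, add_sub_cancel]

end WeakLimits

/-! ### Pure states and compact operators. -/

section CompactCase

variable {A : Type*} [NonUnitalCStarAlgebra A] [PartialOrder A] [StarOrderedRing A]
  {H : Type*} [NormedAddCommGroup H] [InnerProductSpace ℂ H] [CompleteSpace H]
  {π : A →⋆ₙₐ[ℂ] (H →L[ℂ] H)} {f : A →ₚ[ℂ] ℂ}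

/-- An ultrafilter makes the vectors themselves converge weakly by compactness, without passing to
subnets. -/
theorem IsPureState.exists_net_vector_states (hf : IsPureState f)
    (hker : ∀ a, π a = 0 → f.gnsNonUnitalStarAlgHom a = 0) :
    ∃ (𝒰 : Ultrafilter (Finset A × ℕ)) (η : Finset A × ℕ → H), (∀ i, ‖η i‖ = 1) ∧
      ∀ x, Tendsto (fun i => inner ℂ (η i) (π x (η i))) 𝒰 (𝓝 (f x)) := by
  classical
  choose η hη1 hη using fun i : Finset A × ℕ =>
    hf.exists_vector_approx hker i.1 (δ := 1 / ((i.2 : ℝ) + 1)) (by positivity)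
  refine ⟨Ultrafilter.of atTop, η, hη1, fun x => ?_⟩
  refine Tendsto.mono_left ?_ (Ultrafilter.of_le atTop)
  rw [Metric.tendsto_atTop]
  intro ε hε
  obtain ⟨n, hn⟩ := exists_nat_one_div_lt hε
  refine ⟨({x}, n), fun i hi => ?_⟩
  rw [dist_eq_norm]
  refine (hη i x (hi.1 (Finset.mem_singleton_self x))).trans (lt_of_le_of_lt ?_ hn)
  have : (n : ℝ) ≤ i.2 := by exact_mod_cast hi.2
  gcongr

/-- If `π(A)` contains a compact operator that is not killed by `π_f`, a pure state `f` with
`ker π ⊆ ker π_f` is a vector state of `π`. -/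
theorem IsPureState.exists_vector_of_compact (hf : IsPureState f)
    (hker : ∀ a, π a = 0 → f.gnsNonUnitalStarAlgHom a = 0) {a₀ : A}
    (ha₀ : IsCompactOperator (π a₀)) (hne : f.gnsNonUnitalStarAlgHom a₀ ≠ 0) :
    ∃ η : H, ‖η‖ = 1 ∧ ∀ a, f a = inner ℂ η (π a η) := by
  obtain ⟨𝒰, η, hη1, hη⟩ := hf.exists_net_vector_states hker
  obtain ⟨η₀, hη₀, hlim⟩ := exists_weak_limit 𝒰 η fun i => (hη1 i).le
  -- Weak lower semicontinuity of `η ↦ ‖π b η‖²` puts the functional of the weak limit below `f`, so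
  -- by purity it is `t f`.
  obtain ⟨t, -, -, ht⟩ := hf.2 (vectorFunctional π η₀) fun a ha => by
    have hfa := f.map_nonneg ha
    have hva := (vectorFunctional π η₀).map_nonneg ha
    rw [Complex.le_def]
    refine ⟨?_, (Complex.le_def.mp hva).2.symm.trans (Complex.le_def.mp hfa).2⟩
    obtain ⟨b, rfl⟩ := CStarAlgebra.nonneg_iff_eq_star_mul_self.mp ha
    have hsq : ∀ x : H, inner ℂ x (π (star b * b) x) = ((‖π b x‖ ^ 2 : ℝ) : ℂ) := by
      intro x
      have := inner_map_star π (star b) x (π b x)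
      rw [star_star] at this
      rw [map_mul, mul_apply_eq_comp, ← this, inner_self_eq_norm_sq_to_K]
      simp
    have h1 : Tendsto (fun i => ‖π b (η i)‖ ^ 2) 𝒰 (𝓝 (f (star b * b)).re) := by
      have := (Complex.continuous_re.tendsto _).comp (hη (star b * b))
      refine this.congr fun i => ?_
      rw [Function.comp_apply, hsq, Complex.ofReal_re]
    have h2 : Tendsto (fun i => 2 * (inner ℂ (η i) (π (star b * b) η₀)).re - ‖π b η₀‖ ^ 2) 𝒰
        (𝓝 (2 * ‖π b η₀‖ ^ 2 - ‖π b η₀‖ ^ 2)) := by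
      have := (Complex.continuous_re.tendsto _).comp (hlim (π (star b * b) η₀))
      rw [hsq, Complex.ofReal_re] at this
      exact (this.const_mul 2).sub_const _
    have h3 : ∀ i, 2 * (inner ℂ (η i) (π (star b * b) η₀)).re - ‖π b η₀‖ ^ 2 ≤
        ‖π b (η i)‖ ^ 2 := by
      intro i
      have h4 := inner_map_star π (star b) (η i) (π b η₀)
      rw [star_star] at h4
      rw [map_mul, mul_apply_eq_comp, ← h4]
      have h5 := norm_sub_sq (𝕜 := ℂ) (π b (η i)) (π b η₀)
      rw [RCLike.re_to_complex] at h5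
      nlinarith [sq_nonneg ‖π b (η i) - π b η₀‖]
    have := le_of_tendsto_of_tendsto' h2 h1 h3
    rw [vectorFunctional_apply, hsq, Complex.ofReal_re]
    linarith
  -- Possibly `f a₀ = 0`, but some `y* a₀ x` is not annihilated. It is still represented by a
  -- compact operator, on which no mass is lost in the weak limit; this gives `t = 1`.
  obtain ⟨x, y, hxy⟩ : ∃ x y : A, f (star y * (a₀ * x)) ≠ 0 := by
    by_contra! h
    refine hne (ContinuousLinearMap.ext fun z => ?_)
    induction z using (denseRange_gnsMk f).induction_on with
    | hp => exact isClosed_eq (by fun_prop) (by fun_prop)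
    | ih x =>
      rw [zero_apply, gns_apply_gnsMk]
      refine (denseRange_gnsMk f).eq_zero_of_inner_right ℂ ?_
      intro y
      rw [inner_gnsMk, h]
  have hcpt : IsCompactOperator (π (star y * (a₀ * x))) := by
    rw [map_mul, map_mul]
    exact (ha₀.comp_clm (π x)).clm_comp (π (star y))
  have hval : f (star y * (a₀ * x)) = vectorFunctional π η₀ (star y * (a₀ * x)) :=
    tendsto_nhds_unique (hη _)
      (IsCompactOperator.tendsto_inner_of_weak_limit hcpt (fun i => (hη1 i).le) hlim)
  have ht1 : (t : ℂ) = 1 := by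
    have := ht (star y * (a₀ * x))
    rw [← hval] at this
    exact mul_right_cancel₀ hxy (by rw [one_mul]; exact this.symm)
  have hfv : ∀ a, f a = inner ℂ η₀ (π a η₀) := fun a => by
    have := ht a
    rw [ht1, one_mul] at this
    rw [← this, vectorFunctional_apply]
  refine ⟨η₀, le_antisymm hη₀ ?_, hfv⟩
  refine hf.1.le_of_forall_mul_le (norm_nonneg _) fun a => ?_
  rw [one_mul, hfv]
  refine (norm_inner_le_norm _ _).trans ?_
  refine mul_le_mul_of_nonneg_left ?_ (norm_nonneg _)
  refine (ContinuousLinearMap.le_of_opNorm_le _ (norm_representation_le π a) η₀).trans ?_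
  exact mul_le_of_le_one_right (norm_nonneg _) hη₀

/-- Pure states with equal kernels are approximately conjugate by unitaries in the identity
component. -/
theorem IsPureState.exists_path_conj_approx {g : A →ₚ[ℂ] ℂ} (hf : IsPureState f)
    (hg : IsPureState g)
    (hker : ∀ a, f.gnsNonUnitalStarAlgHom a = 0 → g.gnsNonUnitalStarAlgHom a = 0)
    (G : Finset A) {δ : ℝ} (hδ : 0 < δ) :
    ∃ u : ℝ → unitaryGroup A, Continuous u ∧ u 0 = 1 ∧ ∀ x ∈ G, ‖f (Ad (u 1) x) - g x‖ < δ := by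
  obtain ⟨ξ, hξ, -, hfξ⟩ := hf.1.exists_cyclic
  obtain ⟨η, hη, hap⟩ := hg.exists_vector_approx hker G hδ
  obtain ⟨u, hu, hu0, hu1⟩ := hf.isIrreducible.exists_path_inner_eq hξ hη
  refine ⟨u, hu, hu0, fun x hx => ?_⟩
  rw [hfξ, ← hu1]
  exact hap x hx

/-- Pure states with equal kernels are conjugate by a unitary in the identity component if the
GNS representation of the first one has compact operators in its range. -/
theorem IsPureState.exists_path_conj_eq {g : A →ₚ[ℂ] ℂ} (hf : IsPureState f)
    (hg : IsPureState g)
    (hker : ∀ a, f.gnsNonUnitalStarAlgHom a = 0 ↔ g.gnsNonUnitalStarAlgHom a = 0)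
    (hcpt : ¬ MeetsCompactsTrivially f.gnsNonUnitalStarAlgHom) :
    ∃ u : ℝ → unitaryGroup A, Continuous u ∧ u 0 = 1 ∧ ∀ x, g x = f (Ad (u 1) x) := by
  obtain ⟨ξ, hξ, -, hfξ⟩ := hf.1.exists_cyclic
  unfold MeetsCompactsTrivially at hcpt
  push Not at hcpt
  obtain ⟨a₀, ha₀, hne⟩ := hcpt
  obtain ⟨η, hη, hgη⟩ := hg.exists_vector_of_compact (fun a => (hker a).mp) ha₀
    (fun h => hne ((hker a₀).mpr h))
  obtain ⟨u, hu, hu0, hu1⟩ := hf.isIrreducible.exists_path_inner_eq hξ hη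
  exact ⟨u, hu, hu0, fun x => by rw [hgη, hfξ, hu1]⟩

end CompactCase

/-! ### Concatenation of unitary paths. -/

section Concatenation

variable {U : Type*} [Group U] [TopologicalSpace U] [IsTopologicalGroup U]

theorem locallyFinite_Icc_natCast :
    LocallyFinite fun n : ℕ => Set.Icc (n : NNReal) ((n : NNReal) + 1) := by
  intro t
  refine ⟨Set.Iio ((⌊t⌋₊ : NNReal) + 1), Iio_mem_nhds (Nat.lt_floor_add_one t), ?_⟩
  refine (Set.finite_Iio (⌊t⌋₊ + 1)).subset ?_
  rintro n ⟨s, ⟨hs, -⟩, hs'⟩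
  have : (n : NNReal) < (⌊t⌋₊ : NNReal) + 1 := lt_of_le_of_lt hs hs'
  exact_mod_cast this

/-- Concatenation of a sequence of paths that start at the identity. -/
theorem exists_continuous_concat (v : ℕ → U) (p : ℕ → unitInterval → U)
    (hp : ∀ n, Continuous (p n)) (hp0 : ∀ n, p n 0 = 1) (hv : ∀ n, v (n + 1) = v n * p n 1) :
    ∃ V : NNReal → U, Continuous V ∧ (∀ n : ℕ, V n = v n) ∧
      ∀ (n : ℕ) (t : NNReal), n ≤ t → t ≤ n + 1 → ∃ s, V t = v n * p n s := by
  let r : ℕ → NNReal → unitInterval := fun n t =>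
    Set.projIcc (0 : ℝ) 1 zero_le_one ((t : ℝ) - n)
  let V : NNReal → U := fun t => v ⌊t⌋₊ * p ⌊t⌋₊ (r ⌊t⌋₊ t)
  have hr0 : ∀ n : ℕ, r n n = 0 := fun n => by
    have : r n n = Set.projIcc (0 : ℝ) 1 zero_le_one 0 := by simp [r]
    rw [this, Set.projIcc_left]
    rfl
  have hr1 : ∀ n : ℕ, r n ((n : NNReal) + 1) = 1 := fun n => by
    have : r n ((n : NNReal) + 1) = Set.projIcc (0 : ℝ) 1 zero_le_one 1 := by simp [r]
    rw [this, Set.projIcc_right]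
    rfl
  have hVn : ∀ n : ℕ, V n = v n := fun n => by
    change v ⌊(n : NNReal)⌋₊ * p ⌊(n : NNReal)⌋₊ (r ⌊(n : NNReal)⌋₊ n) = v n
    rw [Nat.floor_natCast, hr0, hp0, mul_one]
  have hVt : ∀ (n : ℕ) (t : NNReal), n ≤ t → t ≤ n + 1 → V t = v n * p n (r n t) := by
    intro n t h1 h2
    rcases h2.lt_or_eq with h2 | rfl
    · have : ⌊t⌋₊ = n := (Nat.floor_eq_iff (zero_le)).mpr ⟨h1, h2⟩
      change v ⌊t⌋₊ * p ⌊t⌋₊ (r ⌊t⌋₊ t) = _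
      rw [this]
    · have := hVn (n + 1)
      push_cast at this
      rw [this, hv, hr1]
  refine ⟨V, ?_, hVn, fun n t h1 h2 => ⟨r n t, hVt n t h1 h2⟩⟩
  refine locallyFinite_Icc_natCast.continuous ?_ (fun n => isClosed_Icc) fun n => ?_
  · refine Set.eq_univ_of_forall fun t => Set.mem_iUnion.mpr ⟨⌊t⌋₊, ?_, ?_⟩
    · exact Nat.floor_le (zero_le)
    · exact (Nat.lt_floor_add_one t).le
  · have hc : Continuous fun t => v n * p n (r n t) := by
      refine continuous_const.mul ((hp n).comp (continuous_projIcc.comp ?_))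
      exact NNReal.continuous_coe.sub continuous_const
    exact hc.continuousOn.congr fun t ht => hVt n t ht.1 ht.2

end Concatenation

/-! ### Pointwise limits of inner automorphisms. -/

section Convergence

theorem exists_tendsto_of_geometric {E : Type*} [NormedAddCommGroup E] [CompleteSpace E]
    (h : NNReal → E) (i : ℕ)
    (hh : ∀ n : ℕ, i ≤ n → ∀ t : NNReal, n ≤ t → t ≤ n + 1 → ‖h t - h n‖ ≤ (1 / 2) ^ n) :
    ∃ L, Tendsto h atTop (𝓝 L) := by
  have hc : CauchySeq fun k : ℕ => h ((k + i : ℕ) : NNReal) := by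
    refine cauchySeq_of_le_geometric (1 / 2) 1 (by norm_num) fun k => ?_
    rw [dist_comm, dist_eq_norm, one_mul]
    refine (hh (k + i) (Nat.le_add_left _ _) _ (by push_cast; gcongr; simp) (by push_cast; ring_nf; rfl)).trans ?_
    exact pow_le_pow_of_le_one (by norm_num) (by norm_num) (Nat.le_add_right _ _)
  obtain ⟨L, hL⟩ := cauchySeq_tendsto_of_complete hc
  have hL' : Tendsto (fun n : ℕ => h (n : NNReal)) atTop (𝓝 L) :=
    (tendsto_add_atTop_iff_nat (f := fun n : ℕ => h (n : NNReal)) i).mp hL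
  have hfl : Tendsto (fun t : NNReal => ⌊t⌋₊) atTop atTop := tendsto_nat_floor_atTop
  refine ⟨L, ?_⟩
  have h1 : Tendsto (fun t : NNReal => h t - h (⌊t⌋₊ : NNReal)) atTop (𝓝 0) := by
    have h2 : Tendsto (fun t : NNReal => ((1 / 2 : ℝ)) ^ ⌊t⌋₊) atTop (𝓝 0) :=
      (tendsto_pow_atTop_nhds_zero_of_lt_one (by norm_num) (by norm_num)).comp hfl
    refine squeeze_zero_norm' ?_ h2
    filter_upwards [hfl.eventually_ge_atTop i] with t ht
    exact hh _ ht t (Nat.floor_le (zero_le)) (Nat.lt_floor_add_one t).le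
  have h2 := h1.add (hL'.comp hfl)
  rw [zero_add] at h2
  refine h2.congr fun t => ?_
  simp

/-- Isometry makes the family equicontinuous, so the Cauchy property spreads from the dense range.
-/
theorem exists_tendsto_of_denseRange {E ι κ : Type*} [NormedAddCommGroup E] [CompleteSpace E]
    {l : Filter ι} [l.NeBot] (h : ι → E → E) (hiso : ∀ t x y, ‖h t x - h t y‖ = ‖x - y‖)
    {x : κ → E} (hx : DenseRange x) (hconv : ∀ k, ∃ L, Tendsto (fun t => h t (x k)) l (𝓝 L))
    (y : E) : ∃ L, Tendsto (fun t => h t y) l (𝓝 L) := by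
  rw [← cauchy_map_iff_exists_tendsto, Metric.cauchy_iff]
  refine ⟨inferInstance, fun ε hε => ?_⟩
  obtain ⟨k, hk⟩ := hx.exists_dist_lt y (show 0 < ε / 4 by positivity)
  obtain ⟨L, hL⟩ := hconv k
  have h1 : ∀ᶠ t in l, dist (h t (x k)) L < ε / 4 := Metric.tendsto_nhds.mp hL _ (by positivity)
  refine ⟨(fun t => h t y) '' {t | dist (h t (x k)) L < ε / 4}, image_mem_map h1, ?_⟩
  have h2 : ∀ t, dist (h t (x k)) L < ε / 4 → dist (h t y) L < ε / 2 := by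
    intro t ht
    have h3 : dist (h t y) (h t (x k)) = dist y (x k) := by
      rw [dist_eq_norm, hiso, dist_eq_norm]
    have := dist_triangle (h t y) (h t (x k)) L
    linarith
  rintro _ ⟨s, hs, rfl⟩ _ ⟨t, ht, rfl⟩
  have := dist_triangle_right (h s y) (h t y) L
  linarith [h2 s hs, h2 t ht]

variable {A : Type*} [NonUnitalCStarAlgebra A]

/-- `Ad z_t` is isometric, so `‖Ad z_t⁻¹ y - x‖ = ‖y - Ad z_t x‖`. -/
theorem tendsto_Ad_inv {ι : Type*} {l : Filter ι} {z : ι → unitaryGroup A} {x y : A}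
    (h : Tendsto (fun t => Ad (z t) x) l (𝓝 y)) : Tendsto (fun t => Ad (z t)⁻¹ y) l (𝓝 x) := by
  rw [tendsto_iff_norm_sub_tendsto_zero] at h ⊢
  refine h.congr fun t => ?_
  rw [← norm_Ad (z t)⁻¹, Ad_sub, Ad_inv_Ad, norm_sub_rev]

theorem tendsto_Ad_mul {ι : Type*} {l : Filter ι} {z w : ι → unitaryGroup A} {x y y' : A}
    (h : Tendsto (fun t => Ad (w t) x) l (𝓝 y)) (h' : Tendsto (fun t => Ad (z t) y) l (𝓝 y')) :
    Tendsto (fun t => Ad (z t * w t) x) l (𝓝 y') := by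
  have h1 : Tendsto (fun t => Ad (z t) (Ad (w t) x) - Ad (z t) y) l (𝓝 0) := by
    rw [tendsto_zero_iff_norm_tendsto_zero]
    rw [tendsto_iff_norm_sub_tendsto_zero] at h
    refine h.congr fun t => ?_
    rw [← Ad_sub, norm_Ad]
  have h2 := h1.add h'
  rw [zero_add] at h2
  refine h2.congr fun t => ?_
  rw [sub_add_cancel, Ad_mul]

/-- If `Ad z_t` and its inverses converge pointwise then the limit is an automorphism. -/
theorem exists_starAlgEquiv_of_tendsto {ι : Type*} {l : Filter ι} [l.NeBot]
    (z : ι → unitaryGroup A) (h : ∀ x, ∃ L, Tendsto (fun t => Ad (z t) x) l (𝓝 L))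
    (h' : ∀ x, ∃ L, Tendsto (fun t => Ad (z t)⁻¹ x) l (𝓝 L)) :
    ∃ α : A ≃⋆ₐ[ℂ] A, ∀ x, Tendsto (fun t => Ad (z t) x) l (𝓝 (α x)) := by
  choose α hα using h
  choose β hβ using h'
  refine ⟨{ toFun := α
            invFun := β
            left_inv := fun x => tendsto_nhds_unique (hβ _) (tendsto_Ad_inv (hα x))
            right_inv := fun x => ?_
            map_mul' := fun x y => ?_
            map_add' := fun x y => ?_
            map_star' := fun x => ?_
            map_smul' := fun c x => ?_ }, hα⟩
  · have := tendsto_Ad_inv (hβ x)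
    simp_rw [inv_inv] at this
    exact tendsto_nhds_unique (hα _) this
  · refine tendsto_nhds_unique (hα _) (((hα x).mul (hα y)).congr fun t => ?_)
    exact (map_mul (AdEquiv (z t)) x y).symm
  · refine tendsto_nhds_unique (hα _) (((hα x).add (hα y)).congr fun t => ?_)
    exact (map_add (AdEquiv (z t)) x y).symm
  · refine tendsto_nhds_unique (hα _) (((hα x).star).congr fun t => ?_)
    exact (map_star (AdEquiv (z t)) x).symm
  · refine tendsto_nhds_unique (hα _) (((hα x).const_smul c).congr fun t => ?_)
    exact (map_smul (AdEquiv (z t)) c x).symm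

end Convergence

/-! ### Finite test sets that force convergence. -/

section TestSet

variable {A : Type*} [NonUnitalCStarAlgebra A]

theorem AdEquiv_mem_AI₀ {u : ℝ → unitaryGroup A} (hu : Continuous u) (hu0 : u 0 = 1) :
    AdEquiv (u 1) ∈ AI₀ A := by
  refine ⟨fun t => u (min t 1 : NNReal), ?_, by simp [hu0], fun a => ?_⟩
  · exact hu.comp (NNReal.continuous_coe.comp (continuous_id.min continuous_const))
  · refine tendsto_const_nhds.congr' ?_
    filter_upwards [eventually_ge_atTop 1] with t ht
    rw [min_eq_right ht]
    rfl

open scoped Classical in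
/-- The first `n + 1` terms of `x` together with their images under `Ad v⁻¹`. -/
noncomputable def testSet (x : ℕ → A) (n : ℕ) (v : unitaryGroup A) : Finset A :=
  (Finset.range (n + 1)).image x ∪ (Finset.range (n + 1)).image fun i => Ad v⁻¹ (x i)

theorem mem_testSet (x : ℕ → A) {i n : ℕ} (h : i ≤ n) (v : unitaryGroup A) :
    x i ∈ testSet x n v := by
  classical
  exact Finset.mem_union_left _ (Finset.mem_image_of_mem x (by simpa [Nat.lt_succ_iff] using h))

theorem Ad_inv_mem_testSet (x : ℕ → A) {i n : ℕ} (h : i ≤ n) (v : unitaryGroup A) :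
    Ad v⁻¹ (x i) ∈ testSet x n v := by
  classical
  exact Finset.mem_union_right _
    (Finset.mem_image_of_mem (fun i => Ad v⁻¹ (x i)) (by simpa [Nat.lt_succ_iff] using h))

/-- On the `n`-th interval `Ad V_t = Ad v_n ∘ Ad p`. The forward increment at `x i` has the size of
`Ad p (x i) - x i`, and the inverse increment that of `Ad p y - y` at `y = Ad v_n⁻¹ (x i)`; both
points are tested once `n ≥ i`. -/
theorem exists_starAlgEquiv_of_testSet {x : ℕ → A} (hx : DenseRange x) {v : ℕ → unitaryGroup A}
    {p : ℕ → unitInterval → unitaryGroup A}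
    (hp : ∀ n, ∀ y ∈ testSet x n (v n), ∀ t, ‖Ad (p n t) y - y‖ < (1 / 2) ^ n)
    {V : NNReal → unitaryGroup A} (hV : ∀ n : ℕ, V n = v n)
    (hVt : ∀ (n : ℕ) (t : NNReal), n ≤ t → t ≤ n + 1 → ∃ s, V t = v n * p n s) :
    ∃ α : A ≃⋆ₐ[ℂ] A, ∀ y, Tendsto (fun t => Ad (V t) y) atTop (𝓝 (α y)) := by
  have hiso : ∀ (u : unitaryGroup A) (y z : A), ‖Ad u y - Ad u z‖ = ‖y - z‖ := fun u y z => by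
    rw [← Ad_sub, norm_Ad]
  refine exists_starAlgEquiv_of_tendsto V
    (exists_tendsto_of_denseRange _ (fun t => hiso (V t)) hx fun i => ?_)
    (exists_tendsto_of_denseRange _ (fun t => hiso (V t)⁻¹) hx fun i => ?_)
  · refine exists_tendsto_of_geometric _ i fun n hn t h1 h2 => ?_
    obtain ⟨s, hs⟩ := hVt n t h1 h2
    rw [hs, hV, Ad_mul, hiso]
    exact (hp n _ (mem_testSet x hn _) s).le
  · refine exists_tendsto_of_geometric _ i fun n hn t h1 h2 => ?_
    obtain ⟨s, hs⟩ := hVt n t h1 h2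
    rw [hs, hV, mul_inv_rev, Ad_mul, ← norm_Ad (p n s), Ad_sub, Ad_Ad_inv, norm_sub_rev]
    exact (hp n _ (Ad_inv_mem_testSet x hn _) s).le

end TestSet

/-! ### The back-and-forth construction. -/

section BackAndForth

variable {A : Type*} [NonUnitalCStarAlgebra A] [PartialOrder A] [StarOrderedRing A]

/-- The conclusion of Property A for the states in the unitary orbit of `ψ`, with a given choice of
the tolerances `G` and `δ`. -/
def Controlled (ψ : A →ₚ[ℂ] ℂ) (F : Finset A) (ε : ℝ) (G : Finset A) (δ : ℝ) : Prop :=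
  ∀ v : unitaryGroup A, (∀ x ∈ G, ‖ψ (Ad v x) - ψ x‖ < δ) →
    ∃ p : unitInterval → unitaryGroup A, Continuous p ∧ p 0 = 1 ∧
      (∀ a, ψ (Ad v a) = ψ (Ad (p 1) a)) ∧ ∀ x ∈ F, ∀ t, ‖Ad (p t) x - x‖ < ε

theorem PropertyA.exists_controlled (hA : PropertyA A) {ψ : A →ₚ[ℂ] ℂ} (hψ : IsPureState ψ)
    (hcpt : MeetsCompactsTrivially ψ.gnsNonUnitalStarAlgHom) (F : Finset A) {ε : ℝ} (hε : 0 < ε) :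
    ∃ (G : Finset A) (δ : ℝ), 0 < δ ∧ Controlled ψ F ε G δ := by
  obtain ⟨G, δ, hδ, h⟩ := hA F ψ hψ hcpt ε hε
  exact ⟨G, δ, hδ, fun v hv => h (conjState ψ v) (hψ.conjState v)
    (unitarilyEquivalent_conjState ψ v).quasiEquivalent hv⟩

/-- Finitely many strict inequalities leave a common margin, to be spent in the triangle inequality.
-/
theorem exists_pos_add_le {α : Type*} (G : Finset α) (r : α → ℝ) {δ : ℝ} (h : ∀ x ∈ G, r x < δ) :
    ∃ m : ℝ, 0 < m ∧ ∀ x ∈ G, r x + m ≤ δ := by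
  classical
  induction G using Finset.induction_on with
  | empty => exact ⟨1, one_pos, by simp⟩
  | insert a s _ ih =>
    obtain ⟨m, hm, hs⟩ := ih fun x hx => h x (Finset.mem_insert_of_mem hx)
    have ha := h a (Finset.mem_insert_self a s)
    refine ⟨min m (δ - r a), lt_min hm (by linarith), fun x hx => ?_⟩
    rcases Finset.mem_insert.mp hx with rfl | hx
    · linarith [min_le_right m (δ - r x)]
    · linarith [hs x hx, min_le_left m (δ - r a)]

/-- Move `ψ` close to `ψ'` along a path which is controlled on `F`, and fix the tolerances for
moving `ψ'` in turn. -/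
theorem Controlled.exists_path (hA : PropertyA A) {ψ ψ' : A →ₚ[ℂ] ℂ} (hψ : IsPureState ψ)
    (hψ' : IsPureState ψ')
    (hker : ∀ a, ψ.gnsNonUnitalStarAlgHom a = 0 → ψ'.gnsNonUnitalStarAlgHom a = 0)
    (hcpt : MeetsCompactsTrivially ψ'.gnsNonUnitalStarAlgHom)
    {F : Finset A} {ε : ℝ} {G : Finset A} {δ : ℝ} (hC : Controlled ψ F ε G δ)
    (hclose : ∀ x ∈ G, ‖ψ' x - ψ x‖ < δ) (F' : Finset A) {ε' : ℝ} (hε' : 0 < ε') :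
    ∃ p : unitInterval → unitaryGroup A, Continuous p ∧ p 0 = 1 ∧
      (∀ x ∈ F, ∀ t, ‖Ad (p t) x - x‖ < ε) ∧
      ∃ (G' : Finset A) (δ' : ℝ), Controlled ψ' F' ε' G' δ' ∧
        (∀ x ∈ G', ‖conjState ψ (p 1) x - ψ' x‖ < δ') ∧
        ∀ x ∈ F', ‖conjState ψ (p 1) x - ψ' x‖ < ε' := by
  classical
  -- The tolerances of `ψ'` are available before `ψ` moves, since `ψ'` stays put. A unitary `u 1`
  -- bringing `ψ` close to `ψ'` within them and within the margin `m` keeps `ψ ∘ Ad (u 1)` inside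
  -- the `δ`-neighbourhood of `ψ`, where `Controlled` trades it for a good path.
  obtain ⟨G', δ', hδ', hC'⟩ := hA.exists_controlled hψ' hcpt F' hε'
  obtain ⟨m, hm, hmG⟩ := exists_pos_add_le G _ hclose
  obtain ⟨u, -, -, hu⟩ := hψ.exists_path_conj_approx hψ' hker (G ∪ G' ∪ F')
    (show 0 < min m (min δ' ε') from lt_min hm (lt_min hδ' hε'))
  obtain ⟨p, hp, hp0, hp1, hpF⟩ := hC (u 1) fun x hx => by
    have h1 := hu x (by simp [hx])
    have h2 := hmG x hx
    have h3 := norm_sub_le_norm_sub_add_norm_sub (ψ (Ad (u 1) x)) (ψ' x) (ψ x)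
    linarith [min_le_left m (min δ' ε')]
  refine ⟨p, hp, hp0, hpF, G', δ', hC', fun x hx => ?_, fun x hx => ?_⟩
  · rw [conjState_apply, ← hp1]
    exact (hu x (by simp [hx])).trans_le ((min_le_right _ _).trans (min_le_left _ _))
  · rw [conjState_apply, ← hp1]
    exact (hu x (by simp [hx])).trans_le ((min_le_right _ _).trans (min_le_right _ _))

/-- The invariant of the back-and-forth construction. -/
def Stage (f g : A →ₚ[ℂ] ℂ) (x : ℕ → A) (n : ℕ) (z : unitaryGroup A × unitaryGroup A) : Prop :=
  ∃ (G : Finset A) (δ : ℝ),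
    Controlled (conjState f z.1) (testSet x n z.1) ((1 / 2) ^ n) G δ ∧
    (∀ y ∈ G, ‖conjState g z.2 y - conjState f z.1 y‖ < δ) ∧
    ∀ y ∈ testSet x n z.1, ‖conjState g z.2 y - conjState f z.1 y‖ < (1 / 2) ^ n

variable {f g : A →ₚ[ℂ] ℂ}

theorem gns_conjState_eq_zero_of_imp
    (h : ∀ a, f.gnsNonUnitalStarAlgHom a = 0 → g.gnsNonUnitalStarAlgHom a = 0)
    (u v : unitaryGroup A) (a : A) (ha : (conjState f u).gnsNonUnitalStarAlgHom a = 0) :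
    (conjState g v).gnsNonUnitalStarAlgHom a = 0 :=
  ((unitarilyEquivalent_conjState g v).apply_eq_zero_iff a).2
    (h a (((unitarilyEquivalent_conjState f u).apply_eq_zero_iff a).1 ha))

theorem meetsCompactsTrivially_conjState
    (h : MeetsCompactsTrivially f.gnsNonUnitalStarAlgHom) (u : unitaryGroup A) :
    MeetsCompactsTrivially (conjState f u).gnsNonUnitalStarAlgHom :=
  (unitarilyEquivalent_conjState f u).symm.meetsCompactsTrivially h

/-- The state from `f` moves towards that from `g`, then conversely. The second half fixes
tolerances for `testSet x (n + 1)` at the updated unitary `z.1 * p 1`, which restores the invariant.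
-/
theorem Stage.exists_succ (hA : PropertyA A) (hf : IsPureState f) (hg : IsPureState g)
    (hker : ∀ a, f.gnsNonUnitalStarAlgHom a = 0 ↔ g.gnsNonUnitalStarAlgHom a = 0)
    (hfc : MeetsCompactsTrivially f.gnsNonUnitalStarAlgHom)
    (hgc : MeetsCompactsTrivially g.gnsNonUnitalStarAlgHom) {x : ℕ → A} {n : ℕ}
    {z : unitaryGroup A × unitaryGroup A} (hz : Stage f g x n z) :
    ∃ p q : unitInterval → unitaryGroup A, (Continuous p ∧ p 0 = 1 ∧
      ∀ y ∈ testSet x n z.1, ∀ t, ‖Ad (p t) y - y‖ < (1 / 2) ^ n) ∧ (Continuous q ∧ q 0 = 1 ∧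
      ∀ y ∈ testSet x n z.2, ∀ t, ‖Ad (q t) y - y‖ < (1 / 2) ^ n) ∧
      Stage f g x (n + 1) (z.1 * p 1, z.2 * q 1) := by
  obtain ⟨G, δ, hC, hG, -⟩ := hz
  have hkfg := gns_conjState_eq_zero_of_imp fun a => (hker a).1
  have hkgf := gns_conjState_eq_zero_of_imp fun a => (hker a).2
  obtain ⟨p, hp, hp0, hpF, G', δ', hC', hG', -⟩ := hC.exists_path hA (hf.conjState z.1)
    (hg.conjState z.2) (hkfg z.1 z.2) (meetsCompactsTrivially_conjState hgc z.2) hG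
    (testSet x n z.2) (show (0 : ℝ) < (1 / 2) ^ n by positivity)
  have hG₁ : ∀ y ∈ G', ‖conjState f (z.1 * p 1) y - conjState g z.2 y‖ < δ' := fun y hy => by
    rw [conjState_mul]
    exact hG' y hy
  obtain ⟨q, hq, hq0, hqF, G'', δ'', hC'', hG'', hF''⟩ := hC'.exists_path hA (hg.conjState z.2)
    (hf.conjState (z.1 * p 1)) (hkgf z.2 (z.1 * p 1))
    (meetsCompactsTrivially_conjState hfc (z.1 * p 1)) hG₁
    (testSet x (n + 1) (z.1 * p 1)) (show (0 : ℝ) < (1 / 2) ^ (n + 1) by positivity)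
  refine ⟨p, q, ⟨hp, hp0, hpF⟩, ⟨hq, hq0, hqF⟩, G'', δ'', hC'', fun y hy => ?_, fun y hy => ?_⟩
  · rw [conjState_mul g]
    exact hG'' y hy
  · rw [conjState_mul g]
    exact hF'' y hy

/-- The initial approximation cannot be controlled on a test set, since the states may start far
apart; it is absorbed into the starting point `u 1` of the second path. -/
theorem exists_stage_zero (hA : PropertyA A) (hf : IsPureState f) (hg : IsPureState g)
    (hker : ∀ a, g.gnsNonUnitalStarAlgHom a = 0 → f.gnsNonUnitalStarAlgHom a = 0)
    (hfc : MeetsCompactsTrivially f.gnsNonUnitalStarAlgHom) (x : ℕ → A) :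
    ∃ u : ℝ → unitaryGroup A, Continuous u ∧ u 0 = 1 ∧ Stage f g x 0 (1, u 1) := by
  classical
  obtain ⟨G, δ, hδ, hC⟩ := hA.exists_controlled hf hfc (testSet x 0 1) (one_pos (α := ℝ))
  obtain ⟨u, hu, hu0, hu1⟩ := hg.exists_path_conj_approx hf hker (G ∪ testSet x 0 1)
    (show 0 < min δ 1 from lt_min hδ one_pos)
  refine ⟨u, hu, hu0, G, δ, ?_, fun y hy => ?_, fun y hy => ?_⟩
  · simpa [conjState_one] using hC
  · simp only [conjState_one, conjState_apply]
    exact (hu1 y (Finset.mem_union_left _ hy)).trans_le (min_le_left _ _)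
  · simp only [conjState_one, conjState_apply, pow_zero]
    exact (hu1 y (Finset.mem_union_right _ hy)).trans_le (min_le_right _ _)

theorem exists_mem_AI₀_of_meetsCompactsTrivially [SeparableSpace A] (hA : PropertyA A)
    (hf : IsPureState f) (hg : IsPureState g)
    (hker : ∀ a, f.gnsNonUnitalStarAlgHom a = 0 ↔ g.gnsNonUnitalStarAlgHom a = 0)
    (hfc : MeetsCompactsTrivially f.gnsNonUnitalStarAlgHom)
    (hgc : MeetsCompactsTrivially g.gnsNonUnitalStarAlgHom) :
    ∃ α ∈ AI₀ A, ∀ a, f a = g (α a) := by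
  let x := denseSeq A
  have hx : DenseRange x := denseRange_denseSeq A
  obtain ⟨u, hu, hu0, hstage⟩ := exists_stage_zero hA hf hg (fun a => (hker a).2) hfc x
  have hstep := fun (n : ℕ) (z : {z : unitaryGroup A × unitaryGroup A // Stage f g x n z}) =>
    z.2.exists_succ hA hf hg hker hfc hgc
  choose P Q hP hQ hS using hstep
  let S : ∀ n, {z : unitaryGroup A × unitaryGroup A // Stage f g x n z} := fun n =>
    Nat.rec ⟨(1, u 1), hstage⟩ (fun n z => ⟨(z.1.1 * P n z 1, z.1.2 * Q n z 1), hS n z⟩) n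
  obtain ⟨V, hVc, hV, hVt⟩ := exists_continuous_concat (fun n => (S n).1.1)
    (fun n => P n (S n)) (fun n => (hP n _).1) (fun n => (hP n _).2.1) fun n => rfl
  obtain ⟨W, hWc, hW, hWt⟩ := exists_continuous_concat (fun n => (S n).1.2)
    (fun n => Q n (S n)) (fun n => (hQ n _).1) (fun n => (hQ n _).2.1) fun n => rfl
  obtain ⟨α, hα⟩ := exists_starAlgEquiv_of_testSet hx (fun n => (hP n (S n)).2.2) hV hVt
  obtain ⟨β, hβ⟩ := exists_starAlgEquiv_of_testSet hx (fun n => (hQ n (S n)).2.2) hW hWt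
  have hV0 : V 0 = 1 := (congrArg V Nat.cast_zero.symm).trans (hV 0)
  have hW0 : W 0 = u 1 := (congrArg W Nat.cast_zero.symm).trans (hW 0)
  have hfc' : Continuous f := map_continuous f
  have hgc' : Continuous g := map_continuous g
  have hαc : Continuous α := (NonUnitalStarAlgHom.isometry α α.injective).continuous
  have hβc : Continuous β := (NonUnitalStarAlgHom.isometry β β.injective).continuous
  -- The last clause of `Stage` gives agreement within `(1 / 2) ^ n` at `x i` for all `n ≥ i`.
  have hlim : (fun y => g (β y)) = fun y => f (α y) := by
    refine hx.equalizer (hgc'.comp hβc) (hfc'.comp hαc) (funext fun i => ?_)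
    have h1 : Tendsto (fun n : ℕ => g (Ad (W n) (x i)) - f (Ad (V n) (x i))) atTop
        (𝓝 (g (β (x i)) - f (α (x i)))) :=
      ((hgc'.tendsto _).comp ((hβ (x i)).comp tendsto_natCast_atTop_atTop)).sub
        ((hfc'.tendsto _).comp ((hα (x i)).comp tendsto_natCast_atTop_atTop))
    have h2 : Tendsto (fun n : ℕ => g (Ad (W n) (x i)) - f (Ad (V n) (x i))) atTop (𝓝 0) := by
      refine squeeze_zero_norm' ?_
        (tendsto_pow_atTop_nhds_zero_of_lt_one (r := (1 / 2 : ℝ)) (by norm_num) (by norm_num))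
      filter_upwards [eventually_ge_atTop i] with n hn
      obtain ⟨G, δ, -, -, h⟩ := (S n).2
      rw [hV, hW]
      exact (h (x i) (mem_testSet x hn _)).le
    exact sub_eq_zero.mp (tendsto_nhds_unique h1 h2)
  -- `W` starts at `u 1`. The factor `u (min t 1) * (u 1)⁻¹` makes the product start at `1` and is
  -- trivial from `t = 1` on, so it does not affect the limit.
  refine ⟨α.symm.trans β, ⟨fun t => u (min t 1 : NNReal) * (u 1)⁻¹ * W t * (V t)⁻¹, ?_, ?_, ?_⟩, ?_⟩
  · refine Continuous.mul (Continuous.mul (Continuous.mul (hu.comp ?_) continuous_const) hWc)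
      hVc.inv
    exact NNReal.continuous_coe.comp (continuous_id.min continuous_const)
  · simp [hV0, hW0, hu0]
  · intro a
    have h1 : Tendsto (fun t => Ad (V t)⁻¹ a) atTop (𝓝 (α.symm a)) := by
      have := tendsto_Ad_inv (hα (α.symm a))
      rwa [StarAlgEquiv.apply_symm_apply] at this
    refine (tendsto_Ad_mul h1 (hβ (α.symm a))).congr' ?_
    filter_upwards [eventually_ge_atTop 1] with t ht
    rw [min_eq_right ht]
    simp
  · intro a
    have := congrFun hlim (α.symm a)
    simp only [StarAlgEquiv.apply_symm_apply] at this
    exact this.symm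

end BackAndForth

end CStarPure

/-! ### The main theorem. -/

theorem theorem2p1 {A : Type*} [NonUnitalCStarAlgebra A] [PartialOrder A] [StarOrderedRing A]
    [SeparableSpace A] (hA : CStarPure.PropertyA A)
    (ω₁ ω₂ : A →ₚ[ℂ] ℂ) (h₁ : CStarPure.IsPureState ω₁) (h₂ : CStarPure.IsPureState ω₂)
    (hker : TwoSidedIdeal.ker ω₁.gnsNonUnitalStarAlgHom =
      TwoSidedIdeal.ker ω₂.gnsNonUnitalStarAlgHom) :
    ∃ α ∈ CStarPure.AI₀ A, ∀ a : A, ω₁ a = ω₂ (α a) := by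
  have hker' : ∀ a, ω₁.gnsNonUnitalStarAlgHom a = 0 ↔ ω₂.gnsNonUnitalStarAlgHom a = 0 := by
    intro a
    rw [← TwoSidedIdeal.mem_ker, ← TwoSidedIdeal.mem_ker, hker]
  -- Both states move in the back-and-forth, so both must satisfy the noncompactness hypothesis of
  -- Property A. If either fails, a single unitary conjugates the states exactly.
  by_cases hc₂ : CStarPure.MeetsCompactsTrivially ω₂.gnsNonUnitalStarAlgHom
  · by_cases hc₁ : CStarPure.MeetsCompactsTrivially ω₁.gnsNonUnitalStarAlgHom
    · exact CStarPure.exists_mem_AI₀_of_meetsCompactsTrivially hA h₁ h₂ hker' hc₁ hc₂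
    · obtain ⟨u, hu, hu0, h⟩ := h₁.exists_path_conj_eq h₂ hker' hc₁
      refine ⟨CStarPure.AdEquiv (u 1)⁻¹,
        CStarPure.AdEquiv_mem_AI₀ (u := fun t => (u t)⁻¹) hu.inv (by simp [hu0]), fun a => ?_⟩
      rw [h, CStarPure.AdEquiv_apply, CStarPure.Ad_Ad_inv]
  · obtain ⟨u, hu, hu0, h⟩ := h₂.exists_path_conj_eq h₁ (fun a => (hker' a).symm) hc₂
    exact ⟨CStarPure.AdEquiv (u 1), CStarPure.AdEquiv_mem_AI₀ hu hu0, h⟩
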